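/- Let $Q_n$ be the $n$-dimensional hypercube with vertex set $\{0,1\}^n$. For $0\le k\le n$, a $k$-dimensional subcube $Q_k$ of $Q_n$ is given by an $n$-bit string with exactly $k$ entries replaced by stars; its vertices are obtained by replacing the stars by bits. Its counting vector is $(v_0,\dots,v_k)\in\mathbb{Z}_{\ge 0}^{k+1}$, where $v_i$ is the number of $1$'s in the string that have exactly $i$ stars to their left. Let $d\ge \ell\ge 1$. A $Q_\ell$-coloring of $Q_n$ assigns a color to each $\ell$-dimensional subcube of $Q_n$. It is $d$-polychromatic if every $Q_d$ in $Q_n$ contains a $Q_\ell$ of every color. It is linear if the set of colors is a finite abelian group $Z$ and there is an additive map $\chi:\mathbb{Z}_{\ge 0}^{\ell+1}\to Z$ such that each $Q_\ell$ is colored by the value of $\chi$ at its counting vector; its number of colors is $|Z|$. Let $p_{lin}^\ell(d)$ be the maximum number $M$ such that for all $n\ge d$ the hypercube $Q_n$ has a $d$-polychromatic linear $Q_\ell$-coloring with $M$ colors. **Proposition.** $p_{lin}^2(4)=6$, $p_{lin}^2(5)=9$, $p_{lin}^3(5)=6$, $p_{lin}^2(6)=16$, $p_{lin}^3(6)=12$,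 and $p_{lin}^4(6)=9$. -/

import Mathlib

namespace Polychromatic

/-- A `k`-dimensional subcube `Q_k` of the hypercube `Q_n` (with vertex set `{0,1}^n`, here
`Fin n → Bool`), written as an `n`-bit string with exactly `k` entries replaced by stars:
`none` is a star, `some true` is a `1` and `some false` is a `0`. -/
structure Subcube (n k : ℕ) where
  pattern : Fin n → Option Bool
  card_stars : (Finset.univ.filter fun j => pattern j = none).card = k

/-- The vertices of a subcube: all bit strings obtained by replacing the stars with bits. -/
def Subcube.vertices {n k : ℕ} (A : Subcube n k) : Set (Fin n → Bool) :=
  {x | ∀ j, A.pattern j = none ∨ A.pattern j = some (x j)}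

/-- The counting vector `(v_0, …, v_k)` of a `Q_k`: `v_i` is the number of `1`s that have exactly
`i` stars to their left (so `v_0` counts the `1`s before the first star, `v_k` those after the last
star, and `v_i` those between the `i`-th and the `(i+1)`-st star). -/
def Subcube.countingVector {n k : ℕ} (A : Subcube n k) : Fin (k + 1) → ℕ := fun i =>
  (Finset.univ.filter fun j : Fin n =>
    A.pattern j = some true ∧
      (Finset.univ.filter fun m : Fin n => m < j ∧ A.pattern m = none).card = (i : ℕ)).card

/-- A `Q_ℓ`-coloring of `Q_n` with color set `S` is `d`-polychromatic if every `Q_d` in `Q_n`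
contains a `Q_ℓ` of every color. -/
def IsPolychromatic {n l : ℕ} {S : Type*} (d : ℕ) (c : Subcube n l → S) : Prop :=
  ∀ D : Subcube n d, ∀ s : S, ∃ A : Subcube n l, A.vertices ⊆ D.vertices ∧ c A = s

/-- A `Q_ℓ`-coloring of `Q_n` with values in an abelian group `Z` is linear if it colors each `Q_ℓ`
by the value of an additive map `ℤ_{≥0}^{ℓ+1} → Z` at its counting vector. -/
def IsLinear {n l : ℕ} {Z : Type*} [AddCommGroup Z] (c : Subcube n l → Z) : Prop :=
  ∃ f : (Fin (l + 1) → ℕ) →+ Z, ∀ A : Subcube n l, c A = f A.countingVector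

/-- `Q_n` has a `d`-polychromatic linear `Q_ℓ`-coloring with `M` colors, i.e. one whose color set
is a finite abelian group of order `M`. -/
def HasLinearPolychromaticColoring (n l d M : ℕ) : Prop :=
  ∃ (Z : Type) (_ : AddCommGroup Z) (_ : Finite Z) (c : Subcube n l → Z),
    Nat.card Z = M ∧ IsLinear c ∧ IsPolychromatic d c

/-- `p_lin^ℓ(d) = p`: the number `p` is the maximum number of colors such that for all `n ≥ d`
the hypercube `Q_n` has a `d`-polychromatic linear `Q_ℓ`-coloring with that many colors. -/
def IsPLin (l d p : ℕ) : Prop :=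
  IsGreatest {M : ℕ | ∀ n : ℕ, d ≤ n → HasLinearPolychromaticColoring n l d M} p

end Polychromatic

/-!
A linear coloring is determined by the values `as = [a₀, …, a_ℓ]` of the additive map on the unit
vectors, and the colors it uses inside the subcube given by a word in `0`, `1` and stars are
computed by a recursion along the word (`colorSet`). So `M` colors are possible if and only if
some list in some abelian group of order `M` has the property that no word with `d` stars misses a
color (`hasLinearPolychromaticColoring_iff`).

**Attained values.** Read a word from right to left and record the color sets for all suffixes of
`as`. Zeros change nothing, ones translate each set by a fixed element, and ones after the last
star translate all of them by the same element. Hence, up to translation, only the numbers of ones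
between consecutive stars matter, and these only modulo the exponent of the group. For a given
list this leaves finitely many words, which are run through with subsets of the group as bit masks
(`colorSet_eq_univ_of_uncoveredFrom`).

**Larger values.** The colors in the subcube that consists of stars only are sums of at most
`d - ℓ` of the `ℓ + 1` entries of `as`, with repetitions, which form a *simplex*. Therefore
`M ≤ (d + 1).choose (ℓ + 1)`
(`noColoring_of_choose_lt`), and a list that does not generate the group misses a color. If every
list in every group of order `m` has a word that misses a color, the same is true for `2 * m`, by
passing to the quotient by an element of order two (`NoColoring.two_mul`). The finitely many other
values of `M` are excluded by an exhaustive search (`check`), evaluated by the kernel. It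
enumerates the pairs of a group of order `M` and a generating list, up to isomorphism but with
repetitions: the first entry `b` of maximal order gets the code `1`, further entries are adjoined
to the cyclic group generated by `b` until the order is `M` (`Coding.ext`), and the other entries
form an arbitrary multiset. If the simplex is not the whole group, the word of stars misses a
color; otherwise, for each order of the entries in which `b` is the first of maximal order, a word
of ones and stars that misses a color is searched for. The search need not be complete, since only
its successes are used (`check_sound`).
-/

namespace Polychromatic

open Pointwise

/-! ### Kernel-evaluable search for missed colors -/

noncomputable section

/-- Evaluates `v` to a numeral and passes it to `f`. The recursor makes the kernel compute `v`
before it is substituted, so that a value used several times is computed once. For the same reason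
the functions below are written with recursors, which the kernel unfolds directly. -/
def force {α : Type} (v : ℕ) (f : ℕ → α) : α :=
  Nat.rec (motive := fun _ => α) (f 0) (fun n _ => f (Nat.succ n)) v

/-- `p i` holds for all `i < n`. -/
def allRange (n : ℕ) (p : ℕ → Bool) : Bool :=
  Nat.rec (motive := fun _ => Bool) true (fun i ih => cond (p i) ih false) n

/-- `p x l'` holds for every decomposition of `l` as some entries followed by `x :: l'`. -/
def allList {α : Type} (l : List α) (p : α → List α → Bool) : Bool :=
  List.rec (motive := fun _ => Bool) true (fun x l' ih => cond (p x l') ih false) l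

/-- One of `x, step x, …, step^[n - 1] x` passes the test. -/
def anyIter {α : Type} (step : α → α) (test : α → Bool) (n : ℕ) : α → Bool :=
  Nat.rec (motive := fun _ => α → Bool) (fun _ => false)
    (fun _ ih x => cond (test x) true (ih (step x))) n

/-- Translation by `c` of a subset of a cyclic group of order `n`, given as the bit mask `V`; here
`W = 2 ^ n`. -/
def rotate (W c V : ℕ) : ℕ :=
  force (Nat.shiftLeft V c) fun x => Nat.lor (Nat.mod x W) (Nat.div x W)

/-- Applies `f` to each of the `n` lowest digits of `V` in base `B = 2 ^ N`. -/
def blockMap (N B : ℕ) (f : ℕ → ℕ) (n : ℕ) : ℕ → ℕ :=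
  Nat.rec (motive := fun _ => ℕ → ℕ) (fun _ => 0)
    (fun _ ih V => Nat.lor (f (Nat.mod V B)) (Nat.shiftLeft (force (Nat.div V B) ih) N)) n

/-- Translation of bit masks in an extension. If `t` translates subsets of a group `H` of order
`N` and `a` satisfies `n • a = r` with `n` minimal, then the element `h + k • a` with `h ∈ H`, `k
< n` has code `h + N * k`, and a bit mask consists of `n` blocks of length `B.log2 = N`.
Translating by `y • a` moves the blocks up by `y` places; those that leave at the top come back at
the bottom, translated by `r`. -/
def extTranslate (t : ℕ → ℕ → ℕ) (N B n r c V : ℕ) : ℕ :=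
  force (Nat.mod c N) fun x => force (Nat.div c N) fun y =>
  force (cond (Nat.beq x 0) V (blockMap N B (t x) n V)) fun V => cond (Nat.beq y 0) V <|
      force (Nat.pow 2 (Nat.mul N (Nat.sub n y))) fun K =>
        Nat.lor (Nat.shiftLeft (Nat.mod V K) (Nat.mul N y)) (blockMap N B (t r) y (Nat.div V K))

/-- One step of Pascal's recursion for simplices: from bit masks for the simplices of sizes `j +
1, j + 2, …` on a list and a mask `prev` for the simplex of size `j` on the list with one more
entry, whose translation is `t`, the masks of sizes `j + 1, …` on the longer list are computed and
passed on. -/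
def addElt {α : Type} (t : ℕ → ℕ) (S : List ℕ) : ℕ → (List ℕ → α) → α :=
  List.rec (motive := fun _ => ℕ → (List ℕ → α) → α) (fun _ k => k [])
    (fun s _ ih prev k => force (Nat.lor s (t prev)) fun v => ih v fun tl => k (v :: tl)) S

/-- The last mask of a list, and the mask `1` of `{0}` if the list is empty. -/
def lastSet (S : List ℕ) : ℕ :=
  List.rec (motive := fun _ => ℕ → ℕ) (fun d => d) (fun a _ ih _ => ih a) S 1

/-- None of the first `n` iterates of the translation `t` maps `V` to the mask `1` of `{0}`. For
`V = 1` this says that the translating element has order greater than `n`. -/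
def noReturn (t : ℕ → ℕ) (n : ℕ) : ℕ → Bool :=
  Nat.rec (motive := fun _ => ℕ → Bool) (fun _ => true)
    (fun _ ih V => force (t V) fun V' => cond (Nat.beq V' 1) false (ih V')) n

/-- Effect of a letter `1` on the masks: the set belonging to a suffix of the list of values is
translated by the first entry of that suffix. -/
def ones (t : ℕ → ℕ → ℕ) (cs Bs : List ℕ) : List ℕ :=
  List.rec (motive := fun _ => List ℕ → List ℕ) (fun _ => [])
    (fun B _ ih cs => List.casesOn cs [] fun c cs' => t c B :: ih cs') Bs cs

/-- Effect of a star on the masks `Bs`, which belong to the suffixes of the list of values,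
shorter ones first; `prev` is the mask of the suffix before the first one. The branch is given up
when a mask becomes the full one `F`. -/
def star (t : ℕ → ℕ → ℕ) (F : ℕ) (Bs : List ℕ) : List ℕ → ℕ → (List ℕ → Bool) → Bool :=
  List.rec (motive := fun _ => List ℕ → ℕ → (List ℕ → Bool) → Bool)
    (fun cs prev k => List.casesOn cs (k []) fun _ _ => k [prev])
    (fun B _ ih cs prev k => List.casesOn cs false fun c cs' =>
      force (Nat.lor (Nat.lor B (t c B)) prev) fun v =>
        cond (Nat.beq v F) false (ih cs' B fun tl => k (v :: tl))) Bs

/-- A star, where no suffix has been discarded so far. -/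
def starKeep (t : ℕ → ℕ → ℕ) (F : ℕ) (cs Bs : List ℕ) (k : List ℕ → Bool) : Bool :=
  star t F Bs cs 0 k

/-- A star after which the shortest suffix is discarded: too few stars remain for it to contribute
to the colors of the whole word. -/
def starDrop (t : ℕ → ℕ → ℕ) (F : ℕ) (cs Bs : List ℕ) (k : List ℕ → List ℕ → Bool) : Bool :=
  List.casesOn cs false fun _ cs' => List.casesOn Bs false fun B Bs' =>
    star t F Bs' cs' B (k cs')

/-- Loop over the number of ones after the leftmost star. `Y` is the mask of the list of values
without its first entry, and `X` the union of the mask of the whole list with its translate. -/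
def firstGap (t1 t0 : ℕ → ℕ) (F n : ℕ) : ℕ → ℕ → Bool :=
  Nat.rec (motive := fun _ => ℕ → ℕ → Bool) (fun _ _ => false)
    (fun _ ih Y X => cond (Nat.blt (Nat.lor Y X) F) true
      (force (t1 Y) fun Y' => force (t0 X) fun X' => ih Y' X')) n

/-- The second star from the left, followed by the loop for the leftmost gap. -/
def secondStar (t1 t0 : ℕ → ℕ) (F n B1 B0 Y : ℕ) : Bool :=
  cond (Nat.beq Y F) false <|
    force (Nat.lor (Nat.lor B0 (t0 B0)) B1) fun B0 =>
      force (Nat.lor B0 (t0 B0)) fun X => cond (Nat.beq X F) false (firstGap t1 t0 F n Y X)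

/-- Loop over the number of ones after the second star from the left. -/
def secondGap (t2 t1 t0 : ℕ → ℕ) (F n m : ℕ) : ℕ → ℕ → ℕ → Bool :=
  Nat.rec (motive := fun _ => ℕ → ℕ → ℕ → Bool) (fun _ _ _ => false)
    (fun _ ih B2 B1 B0 => force (t1 B1) fun B1' =>
      cond (force (Nat.lor (Nat.lor B1 B1') B2) (secondStar t1 t0 F n B1 B0)) true
        (force (t2 B2) fun B2' => ih B2' B1' (t0 B0))) m

/-- The search for the part of the word that contains the two leftmost stars. -/
def searchLast (t : ℕ → ℕ → ℕ) (F n : ℕ) (cs Bs : List ℕ) : Bool :=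
  List.casesOn cs false fun c2 cs' => List.casesOn cs' false fun c1 cs'' =>
  List.casesOn cs'' false fun c0 _ =>
  List.casesOn Bs false fun B2 Bs' => List.casesOn Bs' false fun B1 Bs'' =>
  List.casesOn Bs'' false fun B0 _ => secondGap (t c2) (t c1) (t c0) F n n B2 B1 B0

/-- The search over words with `j + 2` further stars, where each star discards the shortest
suffix. -/
def searchDrop (t : ℕ → ℕ → ℕ) (F n : ℕ) (j : ℕ) : List ℕ → List ℕ → Bool :=
  Nat.rec (motive := fun _ => List ℕ → List ℕ → Bool) (searchLast t F n)
    (fun _ ih cs => anyIter (ones t cs) (fun Bs => starDrop t F cs Bs ih) n) j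

/-- The search over words with `j` further stars that discard no suffix, continued by `k`. -/
def searchKeep (t : ℕ → ℕ → ℕ) (F n : ℕ) (k : List ℕ → List ℕ → Bool) (j : ℕ) :
    List ℕ → List ℕ → Bool :=
  Nat.rec (motive := fun _ => List ℕ → List ℕ → Bool) k
    (fun _ ih cs => anyIter (ones t cs) (fun Bs => starKeep t F cs Bs (ih cs)) n) j

/-- Searches for a word with `l + r` stars, and fewer than `n` ones between consecutive stars,
that misses a color. Words are built from right to left, and the codes `cs` of the `l + 1` values
are given in reversed order. -/
def search (t : ℕ → ℕ → ℕ) (F n l r : ℕ) (cs : List ℕ) : Bool :=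
  starKeep t F cs [1] (searchKeep t F n (searchDrop t F n (l - 2)) (r - 1) cs)

/-- `f x rest` holds for every entry `x` of `l`, where `rest` consists of `seen` and the other
entries of `l`. -/
def allPick {α : Type} (l : List α) (f : α → List α → Bool) : List α → Bool :=
  List.rec (motive := fun _ => List α → Bool) (fun _ => true)
    (fun x tl ih seen => cond (f x (List.append seen tl)) (ih (x :: seen)) false) l

/-- The test holds for every list obtained by inserting the code `1` of the base element into an
ordering of the entries of the list such that no entry marked `true` precedes it. The lists are
built from the left, and `test` receives them reversed; the flag `placed` says whether the base
element has been inserted. -/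
def permAll (test : List ℕ → Bool) (k : ℕ) : Bool → List (ℕ × Bool) → List ℕ → Bool :=
  Nat.rec (motive := fun _ => Bool → List (ℕ × Bool) → List ℕ → Bool)
    (fun _ _ acc => test acc)
    (fun _ ih placed av acc =>
      cond placed
        (allPick av (fun x rest => ih true rest (x.1 :: acc)) [])
        (cond (ih true av (1 :: acc))
          (allPick av (fun x rest => cond x.2 true (ih false rest (x.1 :: acc))) []) false)) k

/-- Given the codes `cs` of all values but the base element, either their simplex, whose mask is
the last entry of `S`, is not the whole group, or in every admissible order there is a word that
misses a color. The values marked `true` are those of maximal order, which cannot precede the base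
element because it is the first of them. -/
def leaf (t : ℕ → ℕ → ℕ) (F n l r : ℕ) (S : List ℕ) (cs : List (ℕ × Bool)) : Bool :=
  cond (Nat.blt (lastSet S) F) true (permAll (search t F n l r) (l + 1) false cs [])

/-- `lf` holds for all multisets that arise from `cs` by adding `k` elements of the list `l`,
together with the masks of their simplices. -/
def multichoose (t : ℕ → ℕ → ℕ) (lf : List ℕ → List (ℕ × Bool) → Bool) (k : ℕ) :
    List (ℕ × Bool) → List ℕ → List (ℕ × Bool) → Bool :=
  Nat.rec (motive := fun _ => List (ℕ × Bool) → List ℕ → List (ℕ × Bool) → Bool)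
    (fun _ S cs => lf S cs)
    (fun _ ih l S cs => allList l fun x l' =>
      addElt (t x.1) S 1 fun S' => ih (x :: l') S' (x :: cs)) k

/-- The codes of the elements of order at most `n0`, each with a mark that is `true` if the order
is equal to `n0`. -/
def elements (t : ℕ → ℕ → ℕ) (n0 N : ℕ) : List (ℕ × Bool) :=
  Nat.rec (motive := fun _ => List (ℕ × Bool)) []
    (fun c ih => cond (noReturn (t c) n0 1) ih
      (cond (noReturn (t c) (Nat.pred n0) 1) ((c, true) :: ih) ((c, false) :: ih))) N

/-- Runs through all ways to build a group of order `M` from a subgroup of order `N` with `k` more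
values. As long as `N ≠ M`, one of the values is outside the subgroup; it is adjoined, with least
positive multiple `n` in the subgroup and `n` times it equal to the element with code `q`. As soon
as `N = M`, the other values form an arbitrary multiset. Only values of order at most `n0` occur.
-/
def generators (M F n0 l r : ℕ) (k : ℕ) :
    ℕ → ℕ → (ℕ → ℕ → ℕ) → List ℕ → List (ℕ × Bool) → Bool :=
  Nat.rec (motive := fun _ => ℕ → ℕ → (ℕ → ℕ → ℕ) → List ℕ → List (ℕ × Bool) → Bool)
    (fun N _ t S cs => cond (Nat.beq N M) (leaf t F n0 l r S cs) true)
    (fun k ih N B t S cs => cond (Nat.beq N M)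
      (multichoose t (leaf t F n0 l r) (Nat.succ k) (elements t n0 M) S cs)
      (allRange (Nat.succ (Nat.div M N)) fun n => cond (Nat.ble n 1) true <|
        force (Nat.mul N n) fun N' => cond (Nat.beq (Nat.mod M N') 0)
          (allRange N fun q =>
            (fun t' : ℕ → ℕ → ℕ => cond (noReturn (t' N) n0 1) true
              (addElt (t' N) S 1 fun S' => ih N' (Nat.pow 2 N') t' S'
                ((N, noReturn (t' N) (Nat.pred n0) 1) :: cs)))
              (extTranslate t N B n q)) true)) k

/-- For every abelian group of order `M` and every generating list of `l + 1` elements there is a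
word with `l + r` stars that misses a color. The base element is the first entry of maximal order
`n0`, and it has code `1`. -/
def check (l r M : ℕ) : Bool :=
  force (Nat.pred (Nat.pow 2 M)) fun F =>
  allRange (Nat.succ M) fun n0 => cond (Nat.ble n0 1) true <|
    cond (Nat.beq (Nat.mod M n0) 0) (force (Nat.pow 2 n0) fun W =>
      addElt (rotate W 1) (List.replicate r 1) 1 fun S =>
      generators M F n0 l r l n0 W (rotate W) S []) true

end

section

variable {Z : Type*} [AddCommGroup Z]

/-! ### Color sets -/

/-- The colors of the subcubes `Q_ℓ` inside the subcube given by a word, for the linear coloring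
with values `as = [a₀, …, a_ℓ]` on the unit vectors. A star becomes `0` or `1` or stays a star,
and a `1` counts for the first entry of `as`, which is removed at each star that stays. -/
def colorSet : List (Option Bool) → List Z → Set Z
  | [], as => {z | as.length = 1 ∧ z = 0}
  | some false :: L, as => colorSet L as
  | some true :: L, as => as.headD 0 +ᵥ colorSet L as
  | none :: L, as => colorSet L as ∪ (as.headD 0 +ᵥ colorSet L as) ∪ colorSet L as.tail

theorem colorSet_nil_right (L : List (Option Bool)) : colorSet L ([] : List Z) = ∅ := by
  induction L with
  | nil => ext; simp [colorSet]
  | cons s L ih => rcases s with _ | _ | _ <;> simp [colorSet, ih]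

/-- A word has too few stars to contain subcubes of larger dimension. -/
theorem colorSet_eq_empty (L : List (Option Bool)) (as : List Z)
    (h : L.count none + 1 < as.length) : colorSet L as = ∅ := by
  induction L generalizing as with
  | nil => ext; simp [colorSet] at h ⊢; omega
  | cons s L ih =>
    rcases s with _ | _ | _
    · simp at h
      have h2 : L.count none + 1 < as.tail.length := by simp; omega
      simp [colorSet, ih as (by omega), ih _ h2]
    · simp at h
      simp [colorSet, ih as h]
    · simp at h
      simp [colorSet, ih as h]

theorem colorSet_replicate_false (k : ℕ) (L : List (Option Bool)) (as : List Z) :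
    colorSet (List.replicate k (some false) ++ L) as = colorSet L as := by
  induction k with
  | zero => rfl
  | succ k ih => simpa [List.replicate_succ, colorSet] using ih

/-- In the word of `d` stars, `as.length - 1` of them stay, and each of the others contributes at
most one entry of `as`. -/
theorem exists_sum_of_mem_colorSet_replicate_none (d : ℕ) (as : List Z) (z : Z)
    (hz : z ∈ colorSet (List.replicate d none) as) :
    ∃ s : Multiset Z, s.card + as.length ≤ d + 1 ∧ (∀ x ∈ s, x ∈ as) ∧ s.sum = z := by
  induction d generalizing as z with
  | zero =>
    simp [colorSet] at hz
    exact ⟨0, by simp [hz.1], by simp, by simp [hz.2]⟩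
  | succ d ih =>
    cases as with
    | nil => simp [colorSet_nil_right] at hz
    | cons a as =>
      simp only [List.replicate_succ, colorSet, Set.mem_union] at hz
      rcases hz with (hz | hz) | hz
      · obtain ⟨s, h1, h2, h3⟩ := ih _ _ hz
        exact ⟨s, by omega, h2, h3⟩
      · obtain ⟨y, hy, rfl⟩ := hz
        obtain ⟨s, h1, h2, h3⟩ := ih _ _ hy
        refine ⟨a ::ₘ s, by simp at h1 ⊢; omega, ?_, by simp [h3]⟩
        intro x hx
        rcases Multiset.mem_cons.1 hx with rfl | hx
        · simp
        · exact h2 x hx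
      · obtain ⟨s, h1, h2, h3⟩ := ih _ _ hz
        exact ⟨s, by simp at h1 ⊢; omega, fun x hx => List.mem_cons_of_mem _ (h2 x hx), h3⟩

theorem colorSet_map {Y : Type*} [AddCommGroup Y] (f : Z →+ Y) (L : List (Option Bool))
    (as : List Z) : colorSet L (as.map f) = f '' colorSet L as := by
  induction L generalizing as with
  | nil => ext z; simp [colorSet]; aesop
  | cons s L ih =>
    have hh : (as.map f).headD 0 = f (as.headD 0) := by cases as <;> simp
    have ht : (as.map f).tail = as.tail.map f := by cases as <;> simp
    have hv : ∀ (x : Z) (S : Set Z), f '' (x +ᵥ S) = f x +ᵥ f '' S := by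
      intro x S; ext y; simp [Set.mem_vadd_set]
    rcases s with _ | _ | _ <;> simp only [colorSet, ih, hh, ht, hv, Set.image_union]

/-! ### The simplex -/

/-- The sums of at most `N` entries of `as`, with repetitions. -/
def simplex (N : ℕ) (as : List Z) : Set Z :=
  {z | ∃ s : Multiset Z, s.card ≤ N ∧ (∀ x ∈ s, x ∈ as) ∧ s.sum = z}

theorem simplex_zero (as : List Z) : simplex 0 as = {0} := by
  ext z
  simp only [simplex, nonpos_iff_eq_zero, Multiset.card_eq_zero, Set.mem_ofPred_eq,
    Set.mem_singleton_iff]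
  constructor
  · rintro ⟨s, rfl, -, rfl⟩; simp
  · rintro rfl; exact ⟨0, by simp⟩

theorem simplex_nil (N : ℕ) : simplex N ([] : List Z) = {0} := by
  ext z; simp only [simplex, List.not_mem_nil, imp_false, Set.mem_ofPred_eq, Set.mem_singleton_iff]
  constructor
  · rintro ⟨s, -, hs, rfl⟩; simp [Multiset.eq_zero_of_forall_notMem hs]
  · rintro rfl; exact ⟨0, by simp⟩

theorem simplex_congr (N : ℕ) {as bs : List Z} (h : ∀ x, x ∈ as ↔ x ∈ bs) :
    simplex N as = simplex N bs := by
  simp [simplex, h]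

theorem simplex_succ_cons_subset (N : ℕ) (a : Z) (as : List Z) :
    simplex (N + 1) (a :: as) ⊆ simplex (N + 1) as ∪ (a +ᵥ simplex N (a :: as)) := by
  classical
  rintro z ⟨s, h1, h2, rfl⟩
  by_cases ha : a ∈ s
  · right
    obtain ⟨t, rfl⟩ := Multiset.exists_cons_of_mem ha
    refine ⟨t.sum, ⟨t, by simpa using h1, fun x hx => h2 x (Multiset.mem_cons_of_mem hx), rfl⟩, ?_⟩
    simp
  · left
    refine ⟨s, h1, fun x hx => ?_, rfl⟩
    rcases List.mem_cons.1 (h2 x hx) with rfl | h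
    · exact absurd hx ha
    · exact h

/-- Pascal's rule. -/
theorem ncard_simplex_le (N : ℕ) (as : List Z) :
    (simplex N as).Finite ∧ (simplex N as).ncard ≤ (N + as.length).choose as.length := by
  induction as generalizing N with
  | nil => simp [simplex_nil]
  | cons a as ih =>
    induction N with
    | zero => simp [simplex_zero]
    | succ N ihN =>
      have hfin : (a +ᵥ simplex N (a :: as)).Finite := ihN.1.vadd_set
      have hf := (ih (N + 1)).1.union hfin
      refine ⟨hf.subset (simplex_succ_cons_subset N a as), ?_⟩
      refine (Set.ncard_le_ncard (simplex_succ_cons_subset N a as) hf).trans ?_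
      refine (Set.ncard_union_le _ _).trans ?_
      have h2 : (a +ᵥ simplex N (a :: as)).ncard = (simplex N (a :: as)).ncard :=
        Set.ncard_image_of_injective _ (add_right_injective a)
      rw [h2]
      refine (Nat.add_le_add (ih (N + 1)).2 ihN.2).trans ?_
      simp only [List.length_cons]
      rw [show N + 1 + (as.length + 1) = (N + (as.length + 1)) + 1 by ring,
        Nat.choose_succ_succ' (N + (as.length + 1)) as.length,
        show N + 1 + as.length = N + (as.length + 1) by ring]

theorem simplex_subset_closure (N : ℕ) (as : List Z) :
    simplex N as ⊆ AddSubgroup.closure {x | x ∈ as} := by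
  rintro z ⟨s, -, h, rfl⟩
  exact AddSubgroup.multiset_sum_mem _ _ fun x hx => AddSubgroup.subset_closure (h x hx)

/-- Some word with `d` stars and bounded length misses a color. The bound allows one dimension `n`
to serve for all colorings with `M` colors. -/
def MissesColor (M d : ℕ) (as : List Z) : Prop :=
  ∃ D : List (Option Bool), D.count none = d ∧ D.length ≤ d * (M + 1) ∧
    colorSet D as ≠ Set.univ

/-- The word consisting of stars only has no colors outside the simplex. -/
theorem missesColor_of_simplex_ne_univ {M d N : ℕ} {as : List Z} (h : d + 1 = N + as.length)
    (hs : simplex N as ≠ Set.univ) : MissesColor M d as := by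
  refine ⟨List.replicate d none, by simp, by simp; nlinarith, fun hu => hs ?_⟩
  refine Set.eq_univ_of_univ_subset (hu ▸ ?_)
  intro z hz
  obtain ⟨s, h1, h2, h3⟩ := exists_sum_of_mem_colorSet_replicate_none d as z hz
  exact ⟨s, by omega, h2, h3⟩

end

section

variable {X : Type*} {Z : Type*} [AddCommGroup Z]

/-! ### Codings of abelian groups -/

theorem force_eq {α : Type} (v : ℕ) (f : ℕ → α) : force v f = f v := by cases v <;> rfl

/-- The set of elements whose codes are the positions of the binary digits `1` of `V`. -/
def bitImage (e : ℕ → X) (V : ℕ) : Set X := {z | ∃ p, V.testBit p = true ∧ e p = z}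

theorem bitImage_zero (e : ℕ → X) : bitImage e 0 = ∅ := by ext; simp [bitImage]

theorem bitImage_one (e : ℕ → X) : bitImage e 1 = {e 0} := by
  have h : ∀ p, Nat.testBit 1 p = true ↔ p = 0 := by
    intro p
    rw [← pow_zero 2, Nat.testBit_two_pow]
    simp [eq_comm]
  ext z; simp [bitImage, h, eq_comm (a := z)]

theorem bitImage_lor (e : ℕ → X) (U V : ℕ) :
    bitImage e (Nat.lor U V) = bitImage e U ∪ bitImage e V := by
  change bitImage e (U ||| V) = _
  ext z; simp only [bitImage, Nat.testBit_or, Bool.or_eq_true, Set.mem_ofPred_eq, Set.mem_union]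
  constructor
  · rintro ⟨p, h | h, rfl⟩ <;> [left; right] <;> exact ⟨p, h, rfl⟩
  · rintro (⟨p, h, rfl⟩ | ⟨p, h, rfl⟩) <;> exact ⟨p, by simp [h], rfl⟩

theorem bitImage_shiftLeft (e : ℕ → X) (V s : ℕ) :
    bitImage e (Nat.shiftLeft V s) = bitImage (fun p => e (s + p)) V := by
  change bitImage e (V <<< s) = _
  ext z; simp only [bitImage, Nat.testBit_shiftLeft, Set.mem_ofPred_eq, Bool.and_eq_true,
    decide_eq_true_eq]
  constructor
  · rintro ⟨p, ⟨h, h'⟩, rfl⟩; exact ⟨p - s, h', by congr 1; omega⟩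
  · rintro ⟨p, h, rfl⟩; exact ⟨s + p, by simp [h], rfl⟩

theorem bitImage_split (e : ℕ → X) (V s : ℕ) :
    bitImage e V = bitImage e (V % 2 ^ s) ∪ bitImage (fun p => e (s + p)) (V / 2 ^ s) := by
  ext z; simp only [bitImage, Nat.testBit_mod_two_pow, Nat.testBit_div_two_pow, Set.mem_ofPred_eq,
    Set.mem_union, Bool.and_eq_true, decide_eq_true_eq]
  constructor
  · rintro ⟨p, h, rfl⟩
    by_cases hp : p < s
    · exact Or.inl ⟨p, ⟨hp, h⟩, rfl⟩
    · exact Or.inr ⟨p - s, by rwa [Nat.sub_add_cancel (by omega)], by congr 1; omega⟩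
  · rintro (⟨p, h, rfl⟩ | ⟨p, h, rfl⟩)
    · exact ⟨p, h.2, rfl⟩
    · exact ⟨s + p, by rwa [add_comm], rfl⟩

theorem bitImage_congr {e e' : ℕ → X} {N V : ℕ} (hV : V < 2 ^ N) (h : ∀ p < N, e p = e' p) :
    bitImage e V = bitImage e' V := by
  have key : ∀ p, V.testBit p = true → p < N := fun p hp => by
    by_contra hn
    have := Nat.ge_two_pow_of_testBit hp
    have := Nat.pow_le_pow_right (n := 2) (by norm_num) (not_lt.1 hn)
    omega
  ext z; simp only [bitImage, Set.mem_ofPred_eq]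
  constructor <;> rintro ⟨p, hp, rfl⟩
  · exact ⟨p, hp, (h p (key p hp)).symm⟩
  · exact ⟨p, hp, h p (key p hp)⟩

theorem bitImage_vadd (e : ℕ → Z) (V : ℕ) (z : Z) :
    bitImage (fun p => z + e p) V = z +ᵥ bitImage e V := by
  ext y; simp [bitImage, Set.mem_vadd_set]

theorem lt_of_testBit {N V p : ℕ} (hV : V < 2 ^ N) (hp : V.testBit p = true) : p < N := by
  by_contra hn
  have := Nat.ge_two_pow_of_testBit hp
  have := Nat.pow_le_pow_right (n := 2) (by norm_num) (not_lt.1 hn)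
  omega

theorem lor_lt {N U V : ℕ} (hU : U < 2 ^ N) (hV : V < 2 ^ N) : Nat.lor U V < 2 ^ N :=
  Nat.or_lt_two_pow hU hV

/-- An enumeration `e` of the subgroup `H` by the codes `0, …, N - 1`, where `0` has code `0`,
together with a function `t` such that `t c V` is the bit mask of the translate of the set with
mask `V` by the element with code `c`. -/
structure Coding (H : AddSubgroup Z) (e : ℕ → Z) (N : ℕ) (t : ℕ → ℕ → ℕ) : Prop where
  zero : e 0 = 0
  pos : 0 < N
  inj : ∀ p < N, ∀ q < N, e p = e q → p = q
  mem : ∀ z, z ∈ H ↔ ∃ p < N, e p = z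
  lt : ∀ c < N, ∀ V < 2 ^ N, t c V < 2 ^ N
  image : ∀ c < N, ∀ V < 2 ^ N, bitImage e (t c V) = e c +ᵥ bitImage e V

/-- Positions are counted modulo the order of the cyclic group. -/
theorem bitImage_fold {e : ℕ → X} {n : ℕ} (he : ∀ p, e (n + p) = e p) (x : ℕ) :
    bitImage e (Nat.lor (x % 2 ^ n) (x / 2 ^ n)) = bitImage e x := by
  rw [bitImage_lor, bitImage_split e x n]; simp [he]

theorem coding_zmultiples {a : Z} {n : ℕ} (hn : 0 < n) (ha : addOrderOf a = n) :
    Coding (AddSubgroup.zmultiples a) (fun p => p • a) n (rotate (2 ^ n)) where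
  zero := by simp
  pos := hn
  inj := by
    intro p hp q hq h
    exact nsmul_injOn_Iio_addOrderOf (by simpa [ha] using hp) (by simpa [ha] using hq) h
  mem := by
    intro z
    have hfin : IsOfFinAddOrder a := addOrderOf_pos_iff.1 (ha ▸ hn)
    classical
    rw [hfin.mem_zmultiples_iff_mem_range_addOrderOf]
    simp [ha]
  lt := by
    intro c hc V hV
    simp only [rotate, force_eq]
    refine lor_lt (Nat.mod_lt _ (by positivity)) ?_
    change (V <<< c) / 2 ^ n < 2 ^ n
    rw [Nat.shiftLeft_eq]
    refine (Nat.div_lt_iff_lt_mul (by positivity)).2 ?_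
    exact Nat.mul_lt_mul'' hV (Nat.pow_lt_pow_right (by norm_num) hc)
  image := by
    intro c hc V hV
    simp only [rotate, force_eq]
    have h : ∀ p : ℕ, (n + p) • a = p • a := by
      intro p; rw [add_smul, ← ha, addOrderOf_nsmul_eq_zero, zero_add]
    rw [show ∀ x, Nat.lor (Nat.mod x (2 ^ n)) (Nat.div x (2 ^ n)) = Nat.lor (x % 2 ^ n) (x / 2 ^ n)
      from fun _ => rfl, bitImage_fold h, bitImage_shiftLeft]
    simp only [add_smul, bitImage_vadd]

/-- The enumeration `h + N * k ↦ e h + k • a` of an extension of the subgroup enumerated by `e`.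
-/
def extEval (e : ℕ → Z) (N : ℕ) (a : Z) (p : ℕ) : Z := (p / N) • a + e (p % N)

theorem extEval_lt (e : ℕ → Z) {N : ℕ} (a : Z) {p : ℕ} (hp : p < N) : extEval e N a p = e p := by
  simp [extEval, Nat.div_eq_of_lt hp, Nat.mod_eq_of_lt hp]

theorem extEval_add (e : ℕ → Z) {N : ℕ} (hN : 0 < N) (a : Z) (k p : ℕ) :
    extEval e N a (N * k + p) = k • a + extEval e N a p := by
  simp [extEval, Nat.mul_add_div hN, add_smul, add_assoc]

theorem blockMap_spec {e : ℕ → Z} {N : ℕ} (hN : 0 < N) (a x : Z) {f : ℕ → ℕ}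
    (hf : ∀ U < 2 ^ N, f U < 2 ^ N) (hfe : ∀ U < 2 ^ N, bitImage e (f U) = x +ᵥ bitImage e U)
    (k V : ℕ) (hV : V < 2 ^ (N * k)) :
    blockMap N (2 ^ N) f k V < 2 ^ (N * k) ∧
      bitImage (extEval e N a) (blockMap N (2 ^ N) f k V) =
        x +ᵥ bitImage (extEval e N a) V := by
  induction k generalizing V with
  | zero =>
    obtain rfl : V = 0 := by simpa using hV
    simp [blockMap, bitImage_zero]
  | succ k ih =>
    have hdef : blockMap N (2 ^ N) f (k + 1) V =
        Nat.lor (f (V % 2 ^ N)) (Nat.shiftLeft (blockMap N (2 ^ N) f k (V / 2 ^ N)) N) := by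
      have : blockMap N (2 ^ N) f (k + 1) V = Nat.lor (f (V % 2 ^ N))
        (Nat.shiftLeft (force (V / 2 ^ N) (blockMap N (2 ^ N) f k)) N) := rfl
      rw [this, force_eq]
    have hm : V % 2 ^ N < 2 ^ N := Nat.mod_lt _ (by positivity)
    have hd : V / 2 ^ N < 2 ^ (N * k) := by
      rw [Nat.div_lt_iff_lt_mul (by positivity), ← pow_add]
      exact hV
    obtain ⟨h1, h2⟩ := ih _ hd
    have hshift : ∀ U, bitImage (fun p => extEval e N a (N + p)) U =
        a +ᵥ bitImage (extEval e N a) U := by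
      intro U
      rw [← bitImage_vadd]
      congr 1; ext p
      simpa using extEval_add e hN a 1 p
    have hlow : ∀ U < 2 ^ N, bitImage (extEval e N a) U = bitImage e U := fun U hU =>
      bitImage_congr hU fun p hp => extEval_lt e a hp
    constructor
    · rw [hdef]
      refine lor_lt ((hf _ hm).trans_le (Nat.pow_le_pow_right (by norm_num) (by nlinarith))) ?_
      change _ <<< N < _
      rw [Nat.shiftLeft_eq, show N * (k + 1) = N * k + N by ring, pow_add]
      exact Nat.mul_lt_mul_of_pos_right h1 (by positivity)
    · rw [hdef, bitImage_lor, bitImage_shiftLeft, bitImage_split _ V N, hshift, hshift,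
        hlow _ (hf _ hm), hlow _ hm, hfe _ hm, h2, Set.vadd_set_union, vadd_comm]

/-- A coding of `H` extends to the subgroup generated by `H` and `a`. Every extension arises from
data `n`, `r` of this form, so iterating reaches all finite abelian groups. -/
theorem Coding.ext {H : AddSubgroup Z} {e : ℕ → Z} {N : ℕ} {t : ℕ → ℕ → ℕ}
    (h : Coding H e N t) {a : Z} {n r : ℕ} (hn : 0 < n) (hr : r < N) (hna : n • a = e r)
    (hmin : ∀ k, 0 < k → k < n → k • a ∉ H) :
    Coding (H ⊔ AddSubgroup.zmultiples a) (extEval e N a) (N * n)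
      (extTranslate t N (2 ^ N) n r) := by
  have hN := h.pos
  have hmod : ∀ p, e (p % N) ∈ H := fun p => (h.mem _).2 ⟨_, Nat.mod_lt _ hN, rfl⟩
  have key : ∀ c < N * n, ∀ V < 2 ^ (N * n), extTranslate t N (2 ^ N) n r c V < 2 ^ (N * n) ∧
      bitImage (extEval e N a) (extTranslate t N (2 ^ N) n r c V) =
        extEval e N a c +ᵥ bitImage (extEval e N a) V := by
    intro c hc V hV
    have hx : c % N < N := Nat.mod_lt _ hN
    have hy : c / N < n := Nat.div_lt_of_lt_mul hc
    obtain ⟨V', hV', hlt, himg⟩ : ∃ V', V' = cond (Nat.beq (c % N) 0) V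
        (blockMap N (2 ^ N) (t (c % N)) n V) ∧ V' < 2 ^ (N * n) ∧
        bitImage (extEval e N a) V' = e (c % N) +ᵥ bitImage (extEval e N a) V := by
      refine ⟨_, rfl, ?_⟩
      rcases hb : Nat.beq (c % N) 0 with _ | _
      · exact blockMap_spec hN a _ (h.lt _ hx) (h.image _ hx) n V hV
      · rw [Nat.eq_of_beq_eq_true hb, h.zero]
        simpa using hV
    have hdef : extTranslate t N (2 ^ N) n r c V = cond (Nat.beq (c / N) 0) V'
        (Nat.lor (Nat.shiftLeft (V' % 2 ^ (N * (n - c / N))) (N * (c / N)))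
          (blockMap N (2 ^ N) (t r) (c / N) (V' / 2 ^ (N * (n - c / N))))) := by
      simp only [extTranslate, force_eq, hV']
      rfl
    rw [hdef]
    rcases hb : Nat.beq (c / N) 0 with _ | _
    swap
    · refine ⟨hlt, ?_⟩
      have h0 := Nat.eq_of_beq_eq_true hb
      simp [extEval, h0, himg]
    have hsum : N * n = N * (c / N) + N * (n - c / N) := by rw [← mul_add]; congr 1; omega
    have hhigh : V' / 2 ^ (N * (n - c / N)) < 2 ^ (N * (c / N)) := by
      rw [Nat.div_lt_iff_lt_mul (by positivity), ← pow_add, ← hsum]; exact hlt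
    obtain ⟨h1, h2⟩ := blockMap_spec hN a _ (h.lt _ hr) (h.image _ hr) _ _ hhigh
    have hshift : ∀ k U, bitImage (fun p => extEval e N a (N * k + p)) U =
        (k • a) +ᵥ bitImage (extEval e N a) U := by
      intro k U
      rw [← bitImage_vadd]
      congr 1; ext p
      exact extEval_add e hN a k p
    constructor
    · simp only [cond_false]
      refine lor_lt ?_ (h1.trans_le (Nat.pow_le_pow_right (by norm_num) (by omega)))
      rw [show ∀ a b, Nat.shiftLeft a b = a * 2 ^ b from Nat.shiftLeft_eq, hsum, add_comm, pow_add]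
      exact Nat.mul_lt_mul_of_pos_right (Nat.mod_lt _ (by positivity)) (by positivity)
    · simp only [cond_false]
      rw [bitImage_lor, bitImage_shiftLeft, hshift, h2, ← hna]
      have hs := bitImage_split (extEval e N a) V' (N * (n - c / N))
      rw [hshift] at hs
      rw [extEval, ← vadd_vadd, ← himg, hs, Set.vadd_set_union, vadd_vadd, ← add_smul]
      congr 3; omega
  refine ⟨by simp [extEval, h.zero], Nat.mul_pos hN hn, ?_, ?_, fun c hc V hV => (key c hc V hV).1,
    fun c hc V hV => (key c hc V hV).2⟩
  · -- two codes with equal values have the same top digit by minimality of `n`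
    have aux : ∀ p < N * n, ∀ q < N * n, p / N < q / N → extEval e N a p ≠ extEval e N a q := by
      intro p hp q hq hpq heq
      have hq' : q / N < n := Nat.div_lt_of_lt_mul hq
      refine hmin (q / N - p / N) (Nat.sub_pos_of_lt hpq) ((Nat.sub_le _ _).trans_lt hq') ?_
      have : (q / N - p / N) • a = e (p % N) - e (q % N) := by
        simp only [extEval] at heq
        have h3 : (q / N) • a = (q / N - p / N) • a + (p / N) • a := by
          rw [← add_smul]; congr 1; omega
        rw [h3] at heq
        rw [eq_sub_iff_add_eq]
        have := heq.symm
        rw [add_right_comm, add_comm _ ((p / N) • a)] at this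
        exact add_left_cancel this
      rw [this]
      exact H.sub_mem (hmod p) (hmod q)
    intro p hp q hq heq
    rcases lt_trichotomy (p / N) (q / N) with hlt | heq' | hlt
    · exact absurd heq (aux p hp q hq hlt)
    · simp only [extEval, heq', add_right_inj] at heq
      have := h.inj _ (Nat.mod_lt _ hN) _ (Nat.mod_lt _ hN) heq
      rw [← Nat.div_add_mod p N, ← Nat.div_add_mod q N, heq', this]
    · exact absurd heq.symm (aux q hq p hp hlt)
  · intro z
    rw [AddSubgroup.mem_sup]
    constructor
    · rintro ⟨y, hy, w, hw, rfl⟩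
      obtain ⟨k, rfl⟩ := AddSubgroup.mem_zmultiples_iff.1 hw
      have hn' : (n : ℤ) ≠ 0 := by exact_mod_cast hn.ne'
      have hmodn := Int.emod_nonneg k hn'
      have hk : k • a = (k % n).toNat • a + (k / n) • e r := by
        rw [← hna, ← natCast_zsmul, ← natCast_zsmul, smul_smul, ← add_smul,
          Int.toNat_of_nonneg hmodn,
          mul_comm, Int.emod_add_mul_ediv]
      obtain ⟨p, hp, hpe⟩ := (h.mem (y + (k / n) • e r)).1
        (H.add_mem hy (H.zsmul_mem ((h.mem _).2 ⟨r, hr, rfl⟩) _))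
      have hlt : (k % n).toNat < n := by
        have := Int.emod_lt_of_pos k (by exact_mod_cast hn : (0:ℤ) < n); omega
      refine ⟨N * (k % n).toNat + p, ?_, ?_⟩
      · calc N * (k % n).toNat + p < N * (k % n).toNat + N := by omega
          _ = N * ((k % n).toNat + 1) := by ring
          _ ≤ N * n := Nat.mul_le_mul_left _ hlt
      · rw [extEval_add e hN, extEval_lt e a hp, hpe, hk]; abel
    · rintro ⟨p, -, rfl⟩
      refine ⟨e (p % N), hmod p, (p / N) • a, ?_, by simp [extEval, add_comm]⟩
      exact AddSubgroup.nsmul_mem _ (AddSubgroup.mem_zmultiples a) _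

theorem Coding.bitImage_ne_univ {e : ℕ → Z} {N : ℕ} {t : ℕ → ℕ → ℕ}
    (h : Coding ⊤ e N t) {V : ℕ} (hV : V < 2 ^ N - 1) : bitImage e V ≠ Set.univ := by
  intro hu
  have hall : ∀ p < N, V.testBit p = true := by
    intro p hp
    obtain ⟨q, hq, hqe⟩ : e p ∈ bitImage e V := hu ▸ Set.mem_univ _
    have hqN := lt_of_testBit (by omega : V < 2 ^ N) hq
    rwa [h.inj q hqN p hp hqe] at hq
  have : V = 2 ^ N - 1 := by
    apply Nat.eq_of_testBit_eq
    intro p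
    rw [Nat.testBit_two_pow_sub_one]
    by_cases hp : p < N
    · simp [hp, hall p hp]
    · simp only [hp, decide_false]
      by_contra hc
      exact hp (lt_of_testBit (by omega : V < 2 ^ N) (by simpa using hc))
  omega

theorem Coding.card_eq {H : AddSubgroup Z} {e : ℕ → Z} {N : ℕ} {t : ℕ → ℕ → ℕ}
    (h : Coding H e N t) : Nat.card H = N := by
  have : Function.Bijective (fun p : Fin N => (⟨e p, (h.mem _).2 ⟨p, p.2, rfl⟩⟩ : H)) := by
    constructor
    · intro p q hpq
      exact Fin.ext (h.inj _ p.2 _ q.2 (congrArg Subtype.val hpq))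
    · rintro ⟨z, hz⟩
      obtain ⟨p, hp, rfl⟩ := (h.mem z).1 hz
      exact ⟨⟨p, hp⟩, rfl⟩
  rw [← Nat.card_eq_of_bijective _ this, Nat.card_fin]

end

section

variable {Z : Type*} [AddCommGroup Z]

/-! ### Soundness of the search over words -/

theorem eq_true_of_cond_false {b x : Bool} (h : cond b false x = true) : x = true := by
  cases b
  · exact h
  · exact absurd h Bool.false_ne_true

theorem anyIter_eq_true {α : Type} {step : α → α} {test : α → Bool} {n : ℕ} {x : α}
    (h : anyIter step test n x = true) : ∃ k < n, test (step^[k] x) = true := by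
  induction n generalizing x with
  | zero => exact absurd h Bool.false_ne_true
  | succ n ih =>
    change cond (test x) true (anyIter step test n (step x)) = true at h
    rcases hx : test x with _ | _
    · rw [hx] at h
      obtain ⟨k, hk, hk'⟩ := ih h
      exact ⟨k + 1, by omega, hk'⟩
    · exact ⟨0, by omega, hx⟩

/-- The bit mask `V` represents a set that contains `S`. -/
def Covers {X : Type*} (e : ℕ → X) (M V : ℕ) (S : Set X) : Prop := V < 2 ^ M ∧ S ⊆ bitImage e V

theorem Covers.lor {X : Type*} {e : ℕ → X} {M U V : ℕ} {S T : Set X} (hU : Covers e M U S)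
    (hV : Covers e M V T) : Covers e M (Nat.lor U V) (S ∪ T) :=
  ⟨lor_lt hU.1 hV.1, by rw [bitImage_lor]; exact Set.union_subset_union hU.2 hV.2⟩

section Search

variable {e : ℕ → Z} {M : ℕ} {t : ℕ → ℕ → ℕ}

theorem Covers.translate {H : AddSubgroup Z} (h : Coding H e M t) {c V : ℕ} {S : Set Z}
    (hc : c < M) (hV : Covers e M V S) : Covers e M (t c V) (e c +ᵥ S) :=
  ⟨h.lt c hc V hV.1, by rw [h.image c hc V hV.1]; exact Set.vadd_set_mono hV.2⟩

/-- The masks `Bs` cover the color sets of the word `D` for the suffixes of the list of values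
that consist of `sfx` and a nonempty part of the codes `cs`, which are listed from right to left.
Suffixes without a mask are too long for the number of stars of `D`, so that their color sets are
empty. -/
def IsState (e : ℕ → Z) (M : ℕ) (D : List (Option Bool)) :
    List Z → List ℕ → List ℕ → Prop
  | sfx, cs, [] => cs = [] ∨ D.count none + 1 ≤ sfx.length
  | _, [], _ :: _ => False
  | sfx, c :: cs, B :: Bs =>
    Covers e M B (colorSet D (e c :: sfx)) ∧ IsState e M D (e c :: sfx) cs Bs

theorem isState_nil {D : List (Option Bool)} {sfx : List Z} {cs : List ℕ} :
    IsState e M D sfx cs [] ↔ cs = [] ∨ D.count none + 1 ≤ sfx.length := by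
  cases cs <;> rfl

theorem IsState.ones {H : AddSubgroup Z} (h : Coding H e M t) {D : List (Option Bool)}
    {sfx : List Z} {cs Bs : List ℕ} (hcs : ∀ c ∈ cs, c < M) (hs : IsState e M D sfx cs Bs) :
    IsState e M (some true :: D) sfx cs (ones t cs Bs) := by
  induction Bs generalizing cs sfx with
  | nil => simpa [IsState, Polychromatic.ones] using hs
  | cons B Bs ih =>
    cases cs with
    | nil => exact hs.elim
    | cons c cs =>
      exact ⟨hs.1.translate h (hcs c (by simp)),
        ih (fun x hx => hcs x (List.mem_cons_of_mem _ hx)) hs.2⟩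

theorem IsState.star {H : AddSubgroup Z} (h : Coding H e M t) {D : List (Option Bool)} {F : ℕ}
    {sfx : List Z} {cs Bs : List ℕ} {prev : ℕ} {k : List ℕ → Bool} (hcs : ∀ c ∈ cs, c < M)
    (hs : IsState e M D sfx cs Bs) (hp : Covers e M prev (colorSet D sfx))
    (hk : star t F Bs cs prev k = true) :
    ∃ Bs', k Bs' = true ∧ IsState e M (none :: D) sfx cs Bs' := by
  induction Bs generalizing cs sfx prev k with
  | nil =>
    cases cs with
    | nil => exact ⟨[], hk, Or.inl rfl⟩
    | cons c cs =>
      have hlen : D.count none + 1 ≤ sfx.length := hs.resolve_left (by simp)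
      refine ⟨[prev], hk, ?_, isState_nil.2 (Or.inr (by simpa using hlen))⟩
      rw [colorSet, colorSet_eq_empty D (e c :: sfx) (by simp; omega)]
      simpa using hp
  | cons B Bs ih =>
    cases cs with
    | nil => exact hs.elim
    | cons c cs =>
      change force (Nat.lor (Nat.lor B (t c B)) prev) (fun v =>
        cond (Nat.beq v F) false (Polychromatic.star t F Bs cs B fun tl => k (v :: tl))) = true
        at hk
      rw [force_eq] at hk
      obtain ⟨Bs', hk', hs'⟩ := ih (fun x hx => hcs x (List.mem_cons_of_mem _ hx)) hs.2 hs.1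
        (eq_true_of_cond_false hk)
      exact ⟨_, hk', (hs.1.lor (hs.1.translate h (hcs c (by simp)))).lor hp, hs'⟩

theorem replicate_ones_step {α : Type*} {P : List (Option Bool) → α → Prop} {f : α → α}
    (hf : ∀ D x, P D x → P (some true :: D) (f x)) (k : ℕ) {D : List (Option Bool)} {x : α}
    (hx : P D x) : P (List.replicate k (some true) ++ D) (f^[k] x) := by
  induction k with
  | zero => exact hx
  | succ k ih =>
    rw [Function.iterate_succ_apply', List.replicate_succ]
    exact hf _ _ ih

theorem firstGap_sound (h : Coding ⊤ e M t) {c1 c0 n : ℕ} (h1 : c1 < M) (h0 : c0 < M)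
    {D : List (Option Bool)} {sfx : List Z} {Y X : ℕ}
    (hY : Covers e M Y (colorSet D (e c1 :: sfx)))
    (hX : Covers e M X (colorSet D (e c0 :: e c1 :: sfx) ∪
      (e c0 +ᵥ colorSet D (e c0 :: e c1 :: sfx))))
    (hs : firstGap (t c1) (t c0) (2 ^ M - 1) n Y X = true) :
    ∃ k < n, colorSet (none :: (List.replicate k (some true) ++ D)) (e c0 :: e c1 :: sfx) ≠
      Set.univ := by
  induction n generalizing D Y X with
  | zero => exact absurd hs Bool.false_ne_true
  | succ n ih =>
    change cond (Nat.blt (Nat.lor Y X) (2 ^ M - 1)) true (force (t c1 Y) fun Y' =>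
      force (t c0 X) fun X' => firstGap (t c1) (t c0) (2 ^ M - 1) n Y' X') = true at hs
    simp only [force_eq] at hs
    rcases hb : Nat.blt (Nat.lor Y X) (2 ^ M - 1) with _ | _ <;> rw [hb] at hs
    · obtain ⟨k, hk, hk'⟩ := ih (D := some true :: D) (hY.translate h h1)
        (by have := hX.translate h h0; rwa [Set.vadd_set_union] at this) hs
      refine ⟨k + 1, by omega, ?_⟩
      rw [List.replicate_succ']
      simpa using hk'
    · refine ⟨0, by omega, fun hu => h.bitImage_ne_univ (Nat.le_of_ble_eq_true hb) ?_⟩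
      rw [colorSet, List.headD_cons, List.tail_cons, Set.union_comm] at hu
      exact Set.eq_univ_of_univ_subset (hu ▸ (hY.lor hX).2)

theorem secondGap_sound (h : Coding ⊤ e M t) {c2 c1 c0 n m : ℕ} (h2 : c2 < M) (h1 : c1 < M)
    (h0 : c0 < M) {D : List (Option Bool)} {sfx : List Z} {B2 B1 B0 : ℕ}
    (hB2 : Covers e M B2 (colorSet D (e c2 :: sfx)))
    (hB1 : Covers e M B1 (colorSet D (e c1 :: e c2 :: sfx)))
    (hB0 : Covers e M B0 (colorSet D (e c0 :: e c1 :: e c2 :: sfx)))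
    (hs : secondGap (t c2) (t c1) (t c0) (2 ^ M - 1) n m B2 B1 B0 = true) :
    ∃ k < n, ∃ i < m, colorSet (none :: (List.replicate k (some true) ++
      none :: (List.replicate i (some true) ++ D))) (e c0 :: e c1 :: e c2 :: sfx) ≠ Set.univ := by
  induction m generalizing D B2 B1 B0 with
  | zero => exact absurd hs Bool.false_ne_true
  | succ m ih =>
    change force (t c1 B1) (fun B1' => cond (force (Nat.lor (Nat.lor B1 B1') B2)
      (secondStar (t c1) (t c0) (2 ^ M - 1) n B1 B0)) true (force (t c2 B2) fun B2' =>
        secondGap (t c2) (t c1) (t c0) (2 ^ M - 1) n m B2' B1' (t c0 B0))) = true at hs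
    simp only [force_eq] at hs
    rcases hb : secondStar (t c1) (t c0) (2 ^ M - 1) n B1 B0 (Nat.lor (Nat.lor B1 (t c1 B1)) B2)
      with _ | _ <;> rw [hb] at hs
    · obtain ⟨k, hk, i, hi, hki⟩ := ih (D := some true :: D) (hB2.translate h h2)
        (hB1.translate h h1) (hB0.translate h h0) hs
      refine ⟨k, hk, i + 1, by omega, ?_⟩
      rw [List.replicate_succ']
      simpa using hki
    · have hY : Covers e M _ (colorSet (none :: D) (e c1 :: e c2 :: sfx)) :=
        (hB1.lor (hB1.translate h h1)).lor hB2
      have hX : Covers e M _ (colorSet (none :: D) (e c0 :: e c1 :: e c2 :: sfx)) :=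
        (hB0.lor (hB0.translate h h0)).lor hB1
      simp only [secondStar, force_eq] at hb
      have hb := eq_true_of_cond_false (eq_true_of_cond_false hb)
      obtain ⟨k, hk, hk'⟩ := firstGap_sound h h1 h0 hY (hX.lor (hX.translate h h0)) hb
      exact ⟨k, hk, 0, by omega, hk'⟩

theorem searchLast_sound (h : Coding ⊤ e M t) {n j : ℕ} (hn : n ≤ M) {cs Bs : List ℕ}
    (hcs : ∀ c ∈ cs, c < M) (hlen : cs.length = 3) {D : List (Option Bool)} {sfx : List Z}
    (hj : D.count none = j) (hD : D.length ≤ j * (M + 1)) (hs : IsState e M D sfx cs Bs)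
    (hk : searchLast t (2 ^ M - 1) n cs Bs = true) :
    MissesColor M (j + 2) ((cs.map e).reverseAux sfx) := by
  match cs, hlen with
  | [c2, c1, c0], _ =>
    match Bs, hs with
    | [], _ => exact absurd hk Bool.false_ne_true
    | [_], _ => exact absurd hk Bool.false_ne_true
    | [_, _], _ => exact absurd hk Bool.false_ne_true
    | [B2, B1, B0], hs =>
      obtain ⟨k, hk, i, hi, hne⟩ := secondGap_sound h (hcs c2 (by simp)) (hcs c1 (by simp))
        (hcs c0 (by simp)) hs.1 hs.2.1 hs.2.2.1 hk
      refine ⟨_, ?_, ?_, hne⟩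
      · simp [List.count_replicate, hj]
      · simp; nlinarith

theorem searchDrop_sound (h : Coding ⊤ e M t) {n j : ℕ} (hn : n ≤ M) (q : ℕ) {cs Bs : List ℕ}
    (hcs : ∀ c ∈ cs, c < M) (hlen : cs.length = q + 3) {D : List (Option Bool)} {sfx : List Z}
    (hj : D.count none = j) (hD : D.length ≤ j * (M + 1)) (hs : IsState e M D sfx cs Bs)
    (hk : searchDrop t (2 ^ M - 1) n q cs Bs = true) :
    MissesColor M (j + q + 2) ((cs.map e).reverseAux sfx) := by
  induction q generalizing cs Bs D sfx j with
  | zero => exact searchLast_sound h hn hcs hlen hj hD hs hk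
  | succ q ih =>
    obtain ⟨k, hkn, hk⟩ := anyIter_eq_true hk
    have hs' := replicate_ones_step (P := fun D Bs => IsState e M D sfx cs Bs)
      (fun D x hx => hx.ones h hcs) k hs
    revert hk hs'
    generalize (ones t cs)^[k] Bs = Bs
    intro hk hs'
    match cs, Bs, hs' with
    | [], _, _ => simp at hlen
    | c :: cs, [], _ => exact absurd hk Bool.false_ne_true
    | c :: cs, B :: Bs, hs' =>
      have hcs' : ∀ x ∈ cs, x < M := fun x hx => hcs x (List.mem_cons_of_mem _ hx)
      obtain ⟨Bs', hk', hs''⟩ := IsState.star h hcs' hs'.2 hs'.1 hk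
      have := ih (j := j + 1) hcs' (by simpa using hlen) (by simp [List.count_replicate, hj])
        (by simp; nlinarith) hs'' hk'
      rwa [show j + 1 + q + 2 = j + (q + 1) + 2 by ring] at this

theorem searchKeep_sound {H : AddSubgroup Z} (h : Coding H e M t) {n j d : ℕ} (hn : n ≤ M) (q : ℕ)
    {cs Bs : List ℕ} (hcs : ∀ c ∈ cs, c < M) {D : List (Option Bool)}
    {k : List ℕ → List ℕ → Bool} {as : List Z}
    (hk : ∀ D Bs, D.count none = j + q → D.length ≤ (j + q) * (M + 1) →
      IsState e M D [] cs Bs → k cs Bs = true → MissesColor M d as)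
    (hj : D.count none = j) (hD : D.length ≤ j * (M + 1)) (hs : IsState e M D [] cs Bs)
    (hS : searchKeep t (2 ^ M - 1) n k q cs Bs = true) : MissesColor M d as := by
  induction q generalizing Bs D j with
  | zero => exact hk D Bs hj hD hs hS
  | succ q ih =>
    obtain ⟨i, hin, hS⟩ := anyIter_eq_true hS
    have hs' := replicate_ones_step (P := fun D Bs => IsState e M D [] cs Bs)
      (fun D x hx => hx.ones h hcs) i hs
    have hp : Covers e M 0 (colorSet (List.replicate i (some true) ++ D) ([] : List Z)) :=
      ⟨by positivity, by simp [colorSet_nil_right]⟩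
    obtain ⟨Bs', hk', hs''⟩ := IsState.star h hcs hs' hp hS
    refine ih (j := j + 1) ?_ (by simp [List.count_replicate, hj]) (by simp; nlinarith) hs'' hk'
    intro D Bs h1 h2
    exact hk D Bs (by omega) (by rwa [show j + 1 + q = j + (q + 1) by ring] at h2)

theorem search_sound (h : Coding ⊤ e M t) {n l r : ℕ} (hn : n ≤ M) (hl : 2 ≤ l) (hr : 1 ≤ r)
    {cs : List ℕ} (hcs : ∀ c ∈ cs, c < M) (hlen : cs.length = l + 1)
    (hS : search t (2 ^ M - 1) n l r cs = true) : MissesColor M (l + r) ((cs.map e).reverse) := by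
  match cs, hlen with
  | c :: cs, hlen =>
    have hM : 2 ^ 1 ≤ 2 ^ M := Nat.pow_le_pow_right (by norm_num) h.pos
    have hs : IsState e M [] [] (c :: cs) [1] := by
      refine ⟨⟨by omega, ?_⟩, isState_nil.2 (Or.inr (by simp))⟩
      rintro z ⟨-, rfl⟩
      rw [bitImage_one, h.zero]; rfl
    have hp : Covers e M 0 (colorSet [] ([] : List Z)) :=
      ⟨by positivity, by simp [colorSet_nil_right]⟩
    obtain ⟨Bs', hk', hs'⟩ := IsState.star h hcs hs hp hS
    refine searchKeep_sound (j := 1) h hn (r - 1) hcs ?_ rfl (by simp) hs' hk'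
    intro D Bs h1 h2 h3 h4
    have := searchDrop_sound h hn (l - 2) hcs (by omega) h1 h2 h3 h4
    rwa [show 1 + (r - 1) + (l - 2) + 2 = l + r by omega] at this

end Search

end

section

variable {Z : Type*} [AddCommGroup Z]

theorem and_of_cond_false {b x : Bool} (h : cond b x false = true) : b = true ∧ x = true := by
  cases b
  · exact absurd h Bool.false_ne_true
  · exact ⟨rfl, h⟩

theorem or_of_cond_true {b x : Bool} (h : cond b true x = true) : b = true ∨ x = true := by
  cases b
  · exact Or.inr h
  · exact Or.inl rfl

theorem beq_mod_of_dvd {m n : ℕ} (h : n ∣ m) : Nat.beq (Nat.mod m n) 0 = true := by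
  rw [Nat.beq_eq]
  exact Nat.mod_eq_zero_of_dvd h

theorem allRange_eq_true {n : ℕ} {p : ℕ → Bool} (h : allRange n p = true) :
    ∀ i < n, p i = true := by
  induction n with
  | zero => simp
  | succ n ih =>
    obtain ⟨h1, h2⟩ := and_of_cond_false (x := allRange n p) h
    intro i hi
    rcases Nat.lt_succ_iff_lt_or_eq.1 hi with hi | rfl
    · exact ih h2 i hi
    · exact h1

/-! ### Orderings -/

/-- An ordering of the values of `g` lifts to an ordering of the arguments. -/
theorem exists_perm_of_perm_map {α β : Type*} (g : α → β) {l : List β} {ys : List α}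
    (h : l.Perm (ys.map g)) : ∃ l' : List α, l'.Perm ys ∧ l'.map g = l := by
  induction l generalizing ys with
  | nil =>
    have : ys = [] := by simpa using h.symm.eq_nil
    exact ⟨[], by simp [this], rfl⟩
  | cons z l ih =>
    obtain ⟨y, hy, rfl⟩ := List.mem_map.1 (h.mem_iff.1 List.mem_cons_self)
    obtain ⟨y1, y2, rfl⟩ := List.append_of_mem hy
    have h' : l.Perm ((y1 ++ y2).map g) := by
      have := h.trans ((List.perm_middle (l₁ := y1) (a := y) (l₂ := y2)).map g)
      exact List.Perm.cons_inv this
    obtain ⟨l', hl', rfl⟩ := ih h'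
    exact ⟨y :: l', (hl'.cons y).trans List.perm_middle.symm, rfl⟩

theorem allPick_sound {α : Type} {l seen : List α} {f : α → List α → Bool}
    (h : allPick l f seen = true) {l1 l2 : List α} {x : α} (hl : l = l1 ++ x :: l2) :
    ∃ rest, rest.Perm (seen ++ (l1 ++ l2)) ∧ f x rest = true := by
  induction l generalizing seen l1 with
  | nil => simp at hl
  | cons y tl ih =>
    obtain ⟨h1, h2⟩ := and_of_cond_false (x := allPick tl f (y :: seen)) h
    cases l1 with
    | nil =>
      obtain ⟨rfl, rfl⟩ := List.cons.inj hl
      exact ⟨_, List.Perm.refl _, h1⟩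
    | cons y' l1 =>
      obtain ⟨rfl, rfl⟩ := List.cons.inj hl
      obtain ⟨rest, hr, hf⟩ := ih h2 rfl
      refine ⟨rest, hr.trans ?_, hf⟩
      simpa using (List.perm_middle (l₁ := seen) (a := y) (l₂ := l1 ++ l2)).symm

theorem exists_allPick {α : Type} {av q : List α} {x : α} {f : α → List α → Bool}
    (h : allPick av f [] = true) (hq : (x :: q).Perm av) :
    ∃ rest, q.Perm rest ∧ f x rest = true := by
  obtain ⟨l1, l2, rfl⟩ := List.append_of_mem (hq.mem_iff.1 List.mem_cons_self)
  obtain ⟨rest, hr, hf⟩ := allPick_sound h rfl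
  exact ⟨rest, ((hq.trans List.perm_middle).cons_inv).trans hr.symm, hf⟩

theorem permAll_placed {test : List ℕ → Bool} {k : ℕ} {av q : List (ℕ × Bool)} {acc : List ℕ}
    (h : permAll test k true av acc = true) (hk : q.length = k) (hq : q.Perm av) :
    test ((q.map Prod.fst).reverseAux acc) = true := by
  induction k generalizing av q acc with
  | zero =>
    obtain rfl := List.eq_nil_of_length_eq_zero hk
    exact h
  | succ k ih =>
    cases q with
    | nil => simp at hk
    | cons x q =>
      obtain ⟨rest, hr, hf⟩ := exists_allPick (show allPick av (fun x rest =>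
        permAll test k true rest (x.1 :: acc)) [] = true from h) hq
      exact ih (q := q) (acc := x.1 :: acc) hf (by simpa using hk) hr

/-- All orderings in which the entries `pre` before the base element are unmarked are tested. -/
theorem permAll_sound {test : List ℕ → Bool} {k : ℕ} {av pre post : List (ℕ × Bool)}
    {acc : List ℕ} (h : permAll test k false av acc = true)
    (hk : pre.length + post.length + 1 = k) (hq : (pre ++ post).Perm av)
    (hpre : ∀ x ∈ pre, x.2 = false) :
    test ((pre.map Prod.fst ++ 1 :: post.map Prod.fst).reverseAux acc) = true := by
  induction k generalizing av pre acc with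
  | zero => omega
  | succ k ih =>
    obtain ⟨h1, h2⟩ := and_of_cond_false (b := permAll test k true av (1 :: acc)) (x := allPick av
      (fun x rest => cond x.2 true (permAll test k false rest (x.1 :: acc))) []) h
    cases pre with
    | nil => exact permAll_placed h1 (by simpa using hk) hq
    | cons x pre =>
      obtain ⟨rest, hr, hf⟩ := exists_allPick h2 (show (x :: (pre ++ post)).Perm av from hq)
      rw [hpre x List.mem_cons_self] at hf
      exact ih (pre := pre) (acc := x.1 :: acc) hf (by simp at hk; omega) hr fun y hy =>
        hpre y (List.mem_cons_of_mem _ hy)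

/-! ### Simplices -/

/-- The masks cover the simplices of sizes `j, j + 1, …` on `as`. -/
def IsSimplexState (e : ℕ → Z) (N : ℕ) (as : List Z) : ℕ → List ℕ → Prop
  | _, [] => True
  | j, V :: S => Covers e N V (simplex j as) ∧ IsSimplexState e N as (j + 1) S

section

variable {e : ℕ → Z} {N : ℕ} {t : ℕ → ℕ → ℕ} {H : AddSubgroup Z}

theorem Covers.mono {X : Type*} {e : ℕ → X} {N V : ℕ} {S T : Set X} (h : Covers e N V T)
    (hST : S ⊆ T) : Covers e N V S :=
  ⟨h.1, hST.trans h.2⟩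

theorem covers_one (h : Coding H e N t) : Covers e N 1 {0} := by
  refine ⟨?_, by rw [bitImage_one, h.zero]⟩
  have : 2 ^ 1 ≤ 2 ^ N := Nat.pow_le_pow_right (by norm_num) h.pos
  omega

theorem addElt_sound (h : Coding H e N t) {c j prev : ℕ} (hc : c < N) {as : List Z} {S : List ℕ}
    {k : List ℕ → Bool} (hprev : Covers e N prev (simplex j (e c :: as)))
    (hS : IsSimplexState e N as (j + 1) S) (hk : addElt (t c) S prev k = true) :
    ∃ S', k S' = true ∧ S'.length = S.length ∧ IsSimplexState e N (e c :: as) (j + 1) S' := by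
  induction S generalizing j prev k with
  | nil => exact ⟨[], hk, rfl, trivial⟩
  | cons V S ih =>
    change force (Nat.lor V (t c prev)) (fun v =>
      addElt (t c) S v fun tl => k (v :: tl)) = true at hk
    rw [force_eq] at hk
    have hV := (hS.1.lor (hprev.translate h hc)).mono (simplex_succ_cons_subset j (e c) as)
    obtain ⟨S', h1, h2, h3⟩ := ih hV hS.2 hk
    exact ⟨_, h1, by simp [h2], hV, h3⟩

theorem covers_lastSet (h : Coding H e N t) {as : List Z} {S : List ℕ}
    (hS : IsSimplexState e N as 1 S) : Covers e N (lastSet S) (simplex S.length as) := by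
  have key : ∀ (S : List ℕ) (j V : ℕ), Covers e N V (simplex j as) →
      IsSimplexState e N as (j + 1) S → Covers e N
      (List.rec (motive := fun _ => ℕ → ℕ) (fun d => d) (fun a _ ih _ => ih a) S V)
      (simplex (j + S.length) as) := by
    intro S
    induction S with
    | nil => exact fun j V hV _ => hV
    | cons a S ih =>
      intro j V _ hS
      have := ih (j + 1) a hS.1 hS.2
      rwa [show j + 1 + S.length = j + (a :: S).length by simp; ring] at this
  have := key S 0 1 (by rw [simplex_zero]; exact covers_one h) hS
  rwa [zero_add] at this

theorem IsSimplexState.congr {as bs : List Z} (hab : ∀ x, x ∈ as ↔ x ∈ bs) {j : ℕ} {S : List ℕ}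
    (hS : IsSimplexState e N as j S) : IsSimplexState e N bs j S := by
  induction S generalizing j with
  | nil => trivial
  | cons V S ih => exact ⟨by rw [← simplex_congr j hab]; exact hS.1, ih hS.2⟩

/-- Every multiset `xs` of entries of `l` is among those that are tested, in some order. -/
theorem multichoose_sound {lf : List ℕ → List (ℕ × Bool) → Bool} {k : ℕ} (h : Coding H e N t)
    {b : Z} {l xs cs : List (ℕ × Bool)} {S : List ℕ} (hl : ∀ x ∈ l, x.1 < N)
    (hS : IsSimplexState e N (cs.map (fun x => e x.1) ++ [b]) 1 S)
    (hm : multichoose t lf k l S cs = true) (hk : xs.length = k) (hxs : ∀ x ∈ xs, x ∈ l) :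
    ∃ ys S', ys.Perm (xs ++ cs) ∧ lf S' ys = true ∧ S'.length = S.length ∧
      IsSimplexState e N (ys.map (fun x => e x.1) ++ [b]) 1 S' := by
  induction k generalizing l xs S cs with
  | zero =>
    obtain rfl := List.eq_nil_of_length_eq_zero hk
    exact ⟨cs, S, by simp, hm, rfl, hS⟩
  | succ k ih =>
    change allList l (fun x l' => addElt (t x.1) S 1 fun S' =>
      multichoose t lf k (x :: l') S' (x :: cs)) = true at hm
    induction l with
    | nil =>
      cases xs with
      | nil => simp at hk
      | cons x xs => exact absurd (hxs x List.mem_cons_self) (by simp)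
    | cons y l' ihl =>
      obtain ⟨h1, h2⟩ := and_of_cond_false (b := addElt (t y.1) S 1 fun S' =>
        multichoose t lf k (y :: l') S' (y :: cs)) (x := allList l' _) hm
      by_cases hy : y ∈ xs
      · obtain ⟨S1, hS1, hlen, hst⟩ := addElt_sound h (j := 0) (hl y List.mem_cons_self)
          (by rw [simplex_zero]; exact covers_one h) hS h1
        obtain ⟨x1, x2, rfl⟩ := List.append_of_mem hy
        obtain ⟨ys, S', hp, h3, h4, h5⟩ := ih (l := y :: l') (xs := x1 ++ x2) (cs := y :: cs) hl
          hst hS1 (by simp at hk ⊢; omega)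
          (fun x hx => hxs x (by simp at hx ⊢; tauto))
        refine ⟨ys, S', hp.trans ?_, h3, h4.trans hlen, h5⟩
        simp only [List.append_assoc]
        refine List.Perm.append_left x1 ?_
        simp
      · refine ihl (fun x hx => hl x (List.mem_cons_of_mem _ hx)) (fun x hx => ?_) h2
        rcases List.mem_cons.1 (hxs x hx) with rfl | hx'
        · exact absurd hx hy
        · exact hx'

/-! ### Orders -/

theorem Coding.eq_one (h : Coding H e N t) {V : ℕ} (hV : V < 2 ^ N) (hi : bitImage e V = {0}) :
    V = 1 := by
  have hone : ∀ p, Nat.testBit 1 p = decide (p = 0) := by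
    intro p
    have := Nat.testBit_two_pow (n := 0) (m := p)
    simpa [eq_comm] using this
  have h0 : ∀ p, V.testBit p = true → p = 0 := by
    intro p hp
    have : e p ∈ bitImage e V := ⟨p, hp, rfl⟩
    rw [hi] at this
    exact h.inj p (lt_of_testBit hV hp) 0 h.pos (by rw [h.zero]; exact this)
  obtain ⟨q, hq, -⟩ : (0 : Z) ∈ bitImage e V := by rw [hi]; rfl
  have hq0 := h0 q hq
  apply Nat.eq_of_testBit_eq
  intro p
  rw [hone]
  by_cases hp : p = 0
  · subst hp; subst hq0; simpa using hq
  · simp only [hp, decide_false]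
    by_contra hc
    exact hp (h0 p (by simpa using hc))

theorem noReturn_sound (h : Coding H e N t) {c n : ℕ} (hc : c < N)
    (hr : noReturn (t c) n 1 = true) : ∀ k, 0 < k → k ≤ n → k • e c ≠ 0 := by
  have key : ∀ n j V, V < 2 ^ N → bitImage e V = {j • e c} → noReturn (t c) n V = true →
      ∀ k, j < k → k ≤ j + n → k • e c ≠ 0 := by
    intro n
    induction n with
    | zero => intro j V _ _ _ k h1 h2; omega
    | succ n ih =>
      intro j V hV hi hr k h1 h2
      change force (t c V) (fun V' => cond (Nat.beq V' 1) false (noReturn (t c) n V')) = true at hr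
      rw [force_eq] at hr
      have hlt := h.lt c hc V hV
      have himg : bitImage e (t c V) = {(j + 1) • e c} := by
        rw [h.image c hc V hV, hi, add_comm j, add_smul, one_smul]; simp
      rcases Nat.lt_or_ge (j + 1) k with hk | hk
      · exact ih (j + 1) _ hlt himg (eq_true_of_cond_false hr) k hk (by omega)
      · obtain rfl : k = j + 1 := by omega
        intro h0
        rw [h0] at himg
        rw [h.eq_one hlt himg] at hr
        exact absurd hr Bool.false_ne_true
  intro k h1 h2
  exact key n 0 1 (covers_one h).1 (by rw [bitImage_one, h.zero]; simp) hr k h1 (by omega)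

theorem le_addOrderOf_of_noReturn (h : Coding H e N t) {c n : ℕ} (hc : c < N)
    (ho : 0 < addOrderOf (e c)) (hr : noReturn (t c) n 1 = true) : n < addOrderOf (e c) := by
  by_contra hn
  exact noReturn_sound h hc hr _ ho (by omega) (addOrderOf_nsmul_eq_zero _)

theorem mem_elements (h : Coding H e N t) {n0 c : ℕ} (hc : c < N) (ho : 0 < addOrderOf (e c))
    (hle : addOrderOf (e c) ≤ n0) :
    ∃ f, (c, f) ∈ elements t n0 N ∧ (f = true → n0 ≤ addOrderOf (e c)) := by
  have key : ∀ m, c < m → ∃ f, (c, f) ∈ elements t n0 m ∧ (f = true → n0 ≤ addOrderOf (e c)) := by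
    intro m
    induction m with
    | zero => simp
    | succ m ih =>
      intro hm
      have hdef : elements t n0 (m + 1) = cond (noReturn (t m) n0 1) (elements t n0 m)
        (cond (noReturn (t m) (Nat.pred n0) 1) ((m, true) :: elements t n0 m)
          ((m, false) :: elements t n0 m)) := rfl
      rw [hdef]
      rcases Nat.lt_succ_iff_lt_or_eq.1 hm with hlt | rfl
      · obtain ⟨f, hf, hf'⟩ := ih hlt
        refine ⟨f, ?_, hf'⟩
        cases noReturn (t m) n0 1 <;> cases noReturn (t m) (Nat.pred n0) 1 <;> simp [hf]
      · rcases h1 : noReturn (t c) n0 1 with _ | _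
        · rcases h2 : noReturn (t c) (Nat.pred n0) 1 with _ | _
          · exact ⟨false, by simp, by simp⟩
          · refine ⟨true, by simp, fun _ => ?_⟩
            have := le_addOrderOf_of_noReturn h hc ho h2
            rw [Nat.pred_eq_sub_one] at this
            omega
        · have := le_addOrderOf_of_noReturn h hc ho h1
          omega
  exact key N hc

theorem lt_of_mem_elements {n0 m : ℕ} {x : ℕ × Bool} (hx : x ∈ elements t n0 m) : x.1 < m := by
  induction m with
  | zero => exact absurd hx (by simp [elements])
  | succ m ih =>
    have hdef : elements t n0 (m + 1) = cond (noReturn (t m) n0 1) (elements t n0 m)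
      (cond (noReturn (t m) (Nat.pred n0) 1) ((m, true) :: elements t n0 m)
        ((m, false) :: elements t n0 m)) := rfl
    rw [hdef] at hx
    revert hx
    cases noReturn (t m) n0 1 <;> cases noReturn (t m) (Nat.pred n0) 1 <;>
      simp only [cond_true, cond_false, List.mem_cons] <;> intro hx
    · rcases hx with rfl | hx
      · exact Nat.lt_succ_self _
      · exact (ih hx).trans (Nat.lt_succ_self _)
    · rcases hx with rfl | hx
      · exact Nat.lt_succ_self _
      · exact (ih hx).trans (Nat.lt_succ_self _)
    · exact (ih hx).trans (Nat.lt_succ_self _)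
    · exact (ih hx).trans (Nat.lt_succ_self _)

/-! ### Soundness of the exhaustive check -/

theorem IsSimplexState.mono {e' : ℕ → Z} {N' : ℕ} (hN : N ≤ N') (he : ∀ p < N, e p = e' p)
    {as : List Z} {j : ℕ} {S : List ℕ} (hS : IsSimplexState e N as j S) :
    IsSimplexState e' N' as j S := by
  induction S generalizing j with
  | nil => trivial
  | cons V S ih =>
    refine ⟨⟨hS.1.1.trans_le (Nat.pow_le_pow_right (by norm_num) hN), ?_⟩, ih hS.2⟩
    rw [← bitImage_congr hS.1.1 he]
    exact hS.1.2

theorem leaf_sound {M n0 l r : ℕ} (h : Coding ⊤ e M t) (hM : 1 < M) (hn : n0 ≤ M) (hl : 2 ≤ l)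
    (hr : 1 ≤ r) {S : List ℕ} {cs : List (ℕ × Bool)}
    (hcs : ∀ x ∈ cs, x.1 < M ∧ (x.2 = true → n0 ≤ addOrderOf (e x.1)))
    (hS : IsSimplexState e M (cs.map (fun x => e x.1) ++ [e 1]) 1 S) (hSr : S.length = r)
    (hlen : cs.length = l) (hlf : leaf t (2 ^ M - 1) n0 l r S cs = true) {pre post : List Z}
    (hperm : (pre ++ post).Perm (cs.map fun x => e x.1)) (hpre : ∀ x ∈ pre, addOrderOf x < n0) :
    MissesColor M (l + r) (pre ++ e 1 :: post) := by
  have hpl := hperm.length_eq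
  simp only [List.length_append, List.length_map] at hpl
  rcases or_of_cond_true hlf with hlt | hp
  · refine missesColor_of_simplex_ne_univ (N := r) (by simp; omega) fun hu => ?_
    have hc := covers_lastSet h hS
    refine h.bitImage_ne_univ (V := lastSet S) ?_ (Set.eq_univ_of_univ_subset ?_)
    · exact Nat.lt_of_lt_of_le (Nat.blt_eq ▸ hlt) le_rfl
    · rw [← hu]
      refine Set.Subset.trans (Eq.subset ?_) hc.2
      rw [hSr]
      refine simplex_congr _ fun x => ?_
      have := hperm.mem_iff (a := x)
      simp only [List.mem_append, List.mem_cons, List.not_mem_nil, or_false] at this ⊢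
      tauto
  · obtain ⟨q, hq, hqm⟩ := exists_perm_of_perm_map (fun x : ℕ × Bool => e x.1) hperm
    obtain ⟨pre', post', rfl, rfl, rfl⟩ := List.map_eq_append_iff.1 hqm
    have hpre' : ∀ x ∈ pre', x.2 = false := by
      intro x hx
      by_contra hc
      have h1 := (hcs x (hq.mem_iff.1 (List.mem_append_left _ hx))).2 (by simpa using hc)
      have h2 := hpre _ (List.mem_map_of_mem hx)
      omega
    have hs := permAll_sound hp (by simp at hpl; omega) hq hpre'
    rw [List.reverseAux_eq, List.append_nil] at hs
    have := search_sound h hn hl hr (fun c hc => ?_) (by simp at hpl ⊢; omega) hs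
    · simpa [List.map_reverse, Function.comp_def] using this
    · simp only [List.mem_reverse, List.mem_append, List.mem_cons, List.mem_map] at hc
      rcases hc with ⟨x, hx, rfl⟩ | rfl | ⟨x, hx, rfl⟩
      · exact (hcs x (hq.mem_iff.1 (List.mem_append_left _ hx))).1
      · exact hM
      · exact (hcs x (hq.mem_iff.1 (List.mem_append_right _ hx))).1

/-- The check covers all groups: the values outside the subgroup `H` reached so far are adjoined
in any order in which they enlarge it. -/
theorem generators_sound {M n0 l r : ℕ} (hcard : Nat.card Z = M) (hM : 1 < M) (hn : n0 ≤ M)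
    (hl : 2 ≤ l) (hr : 1 ≤ r) {b : Z} {pre post : List Z}
    (hpre : ∀ x ∈ pre, addOrderOf x < n0) {k : ℕ} {S : List ℕ} {cs : List (ℕ × Bool)}
    {rest : List Z} (h : Coding H e N t) (hN : 1 < N) (he : e 1 = b)
    (hcs : ∀ x ∈ cs, x.1 < N ∧ (x.2 = true → n0 ≤ addOrderOf (e x.1)))
    (hS : IsSimplexState e N (cs.map (fun x => e x.1) ++ [b]) 1 S) (hSr : S.length = r)
    (hk : rest.length = k) (hlen : cs.length + k = l) (hrest : ∀ x ∈ rest, addOrderOf x ≤ n0)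
    (hgen : H ⊔ AddSubgroup.closure {x | x ∈ rest} = ⊤)
    (hperm : (pre ++ post).Perm (rest ++ cs.map fun x => e x.1))
    (hg : generators M (2 ^ M - 1) n0 l r k N (2 ^ N) t S cs = true) :
    MissesColor M (l + r) (pre ++ b :: post) := by
  have : Finite Z := Nat.finite_of_card_ne_zero (by omega)
  induction k generalizing N e t S cs rest H with
  | zero =>
    obtain rfl := List.eq_nil_of_length_eq_zero hk
    obtain rfl : H = ⊤ := by simpa using hgen
    obtain rfl : N = M := by rw [← h.card_eq, ← hcard]; simp
    change cond (Nat.beq N N) _ true = true at hg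
    rw [Nat.beq_refl] at hg
    subst he
    exact leaf_sound h hM hn hl hr hcs hS hSr (by omega) hg (by simpa using hperm) hpre
  | succ k ih =>
    change cond (Nat.beq N M) (multichoose t (leaf t (2 ^ M - 1) n0 l r) (Nat.succ k)
      (elements t n0 M) S cs) (allRange (Nat.succ (Nat.div M N)) fun n => cond (Nat.ble n 1) true <|
        force (Nat.mul N n) fun N' => cond (Nat.beq (Nat.mod M N') 0)
          (allRange N fun q =>
            (fun t' : ℕ → ℕ → ℕ => cond (noReturn (t' N) n0 1) true
              (addElt (t' N) S 1 fun S' => generators M (2 ^ M - 1) n0 l r k N' (Nat.pow 2 N') t' S'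
                ((N, noReturn (t' N) (Nat.pred n0) 1) :: cs)))
              (extTranslate t N (2 ^ N) n q)) true) = true at hg
    by_cases hNM : N = M
    · subst hNM
      rw [Nat.beq_refl, cond_true] at hg
      obtain rfl : H = ⊤ := by
        rw [← AddSubgroup.card_eq_iff_eq_top, h.card_eq, hcard]
      have hcode : ∀ x ∈ rest, ∃ y ∈ elements t n0 N, e y.1 = x ∧
          (y.2 = true → n0 ≤ addOrderOf (e y.1)) := by
        intro x hx
        obtain ⟨c, hc, rfl⟩ := (h.mem x).1 trivial
        obtain ⟨f, hf, hf'⟩ := mem_elements h hc (addOrderOf_pos _) (hrest _ hx)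
        exact ⟨_, hf, rfl, hf'⟩
      choose! g hg1 hg2 hg3 using hcode
      subst he
      obtain ⟨ys, S', hys, hlf, hS'l, hS'⟩ := multichoose_sound h (xs := rest.map g)
        (fun x hx => lt_of_mem_elements hx) hS hg (by simpa using hk) (by
          intro x hx
          obtain ⟨y, hy, rfl⟩ := List.mem_map.1 hx
          exact hg1 y hy)
      refine leaf_sound h hM hn hl hr ?_ hS' (hS'l.trans hSr) ?_ hlf ?_ hpre
      · intro x hx
        rcases List.mem_append.1 (hys.mem_iff.1 hx) with hx | hx
        · obtain ⟨y, hy, rfl⟩ := List.mem_map.1 hx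
          exact ⟨lt_of_mem_elements (hg1 y hy), hg3 y hy⟩
        · exact hcs x hx
      · rw [hys.length_eq]; simp; omega
      · refine hperm.trans ((hys.map _).trans (List.Perm.of_eq ?_)).symm
        rw [List.map_append, List.map_map]
        congr 1
        conv_rhs => rw [← List.map_id rest]
        exact List.map_congr_left fun x hx => hg2 x hx
    · rw [show Nat.beq N M = false by rw [← Bool.not_eq_true, Nat.beq_eq]; exact hNM,
        cond_false] at hg
      obtain ⟨a, ha, haH⟩ : ∃ a ∈ rest, a ∉ H := by
        by_contra! hc
        refine hNM ?_
        rw [sup_eq_left.2 ((AddSubgroup.closure_le (k := {x | x ∈ rest}) H).2 hc)] at hgen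
        rw [← h.card_eq, hgen, ← hcard]; simp
      classical
      have hex : ∃ n, 0 < n ∧ n • a ∈ H :=
        ⟨addOrderOf a, addOrderOf_pos a, by rw [addOrderOf_nsmul_eq_zero]; exact H.zero_mem⟩
      obtain ⟨n, ⟨hn0, hnH⟩, hnmin⟩ : ∃ n, (0 < n ∧ n • a ∈ H) ∧ ∀ k, 0 < k → k < n → k • a ∉ H :=
        ⟨Nat.find hex, Nat.find_spec hex, fun k h1 h2 h3 => Nat.find_min hex h2 ⟨h1, h3⟩⟩
      have hn2 : 2 ≤ n := by
        by_contra hlt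
        obtain rfl : n = 1 := by omega
        exact haH (by simpa using hnH)
      obtain ⟨q, hq, hqe⟩ := (h.mem _).1 hnH
      have h' := h.ext hn0 hq hqe.symm hnmin
      have hdvd : N * n ∣ M := by
        rw [← h'.card_eq, ← hcard]; exact AddSubgroup.card_addSubgroup_dvd_card _
      have hle : N * n ≤ M := Nat.le_of_dvd (by omega) hdvd
      have hNn : N < N * n := by nlinarith
      have heN : extEval e N a N = a := by
        simp [extEval, Nat.div_self h.pos, h.zero]
      have hee : ∀ p < N, e p = extEval e N a p := fun p hp => (extEval_lt e a hp).symm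
      have hg1 := allRange_eq_true hg n
        (Nat.lt_succ_of_le ((Nat.le_div_iff_mul_le h.pos).2 (by rwa [mul_comm])))
      rw [show Nat.ble n 1 = false by rw [← Bool.not_eq_true, Nat.ble_eq]; omega, cond_false,
        force_eq, show Nat.beq (Nat.mod M (Nat.mul N n)) 0 = true from
          beq_mod_of_dvd hdvd, cond_true] at hg1
      have hg2 := allRange_eq_true hg1 q hq
      rcases or_of_cond_true hg2 with hbad | hadd
      · have := le_addOrderOf_of_noReturn h' hNn (addOrderOf_pos _) hbad
        rw [heN] at this
        exact absurd (hrest a ha) (by omega)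
      · have hmap : cs.map (fun x => e x.1) = cs.map fun x => extEval e N a x.1 :=
          List.map_congr_left fun x hx => hee _ (hcs x hx).1
        obtain ⟨S', hgS, hS'l, hS'⟩ := addElt_sound h' (j := 0) hNn
          (by rw [simplex_zero]; exact covers_one h') (hS.mono hNn.le hee) hadd
        obtain ⟨x1, x2, rfl⟩ := List.append_of_mem ha
        refine ih (rest := x1 ++ x2) h' (hN.trans hNn) ?_ ?_ ?_ (hS'l.trans hSr) ?_ ?_ ?_ ?_ ?_ hgS
        · rw [← hee 1 hN, he]
        · intro x hx
          rcases List.mem_cons.1 hx with rfl | hx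
          · refine ⟨hNn, fun hf => ?_⟩
            have := le_addOrderOf_of_noReturn h' hNn (addOrderOf_pos _) hf
            rw [Nat.pred_eq_sub_one] at this
            simp only
            omega
          · rw [← hee _ (hcs x hx).1]
            exact ⟨(hcs x hx).1.trans hNn, (hcs x hx).2⟩
        · simpa [hmap] using hS'
        · simp at hk ⊢; omega
        · simp; omega
        · intro x hx
          exact hrest x (by simp at hx ⊢; tauto)
        · rw [eq_top_iff, ← hgen]
          refine sup_le (le_sup_left.trans le_sup_left) ((AddSubgroup.closure_le _).2 ?_)
          intro x hx
          rcases List.mem_append.1 hx with hx | hx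
          · exact (le_sup_right : _ ≤ _ ⊔ AddSubgroup.closure {x | x ∈ x1 ++ x2})
              (AddSubgroup.subset_closure (List.mem_append_left _ hx))
          · rcases List.mem_cons.1 hx with rfl | hx
            · exact (le_sup_right.trans le_sup_left : AddSubgroup.zmultiples x ≤ _)
                (AddSubgroup.mem_zmultiples x)
            · exact (le_sup_right : _ ≤ _ ⊔ AddSubgroup.closure {x | x ∈ x1 ++ x2})
                (AddSubgroup.subset_closure (List.mem_append_right _ hx))
        · refine hperm.trans ?_
          rw [List.map_cons, heN, ← hmap]
          simp only [List.append_assoc, List.cons_append]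
          refine List.Perm.append_left x1 ?_
          exact List.perm_middle.symm

theorem exists_first_max {α : Type*} (f : α → ℕ) {as : List α} (has : as ≠ []) :
    ∃ pre b post, as = pre ++ b :: post ∧ (∀ x ∈ pre, f x < f b) ∧ ∀ x ∈ post, f x ≤ f b := by
  induction as with
  | nil => exact absurd rfl has
  | cons a as ih =>
    rcases eq_or_ne as [] with rfl | hne
    · exact ⟨[], a, [], rfl, by simp, by simp⟩
    obtain ⟨pre, b, post, rfl, h1, h2⟩ := ih hne
    rcases lt_or_ge (f a) (f b) with hlt | hle
    · refine ⟨a :: pre, b, post, rfl, ?_, h2⟩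
      simpa using ⟨hlt, h1⟩
    · refine ⟨[], a, _, rfl, by simp, ?_⟩
      intro x hx
      rcases List.mem_append.1 hx with hx | hx
      · exact (h1 x hx).le.trans hle
      · rcases List.mem_cons.1 hx with rfl | hx
        · exact hle
        · exact (h2 x hx).trans hle

/-- A successful check for `M` excludes all groups of order `M`. Lists that do not generate the
group are excluded by the word consisting of stars only. -/
theorem check_sound {l r M : ℕ} (hl : 2 ≤ l) (hr : 1 ≤ r) (hM : 1 < M) (hc : check l r M = true)
    (hcard : Nat.card Z = M) {as : List Z} (hlen : as.length = l + 1) :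
    MissesColor M (l + r) as := by
  have : Finite Z := Nat.finite_of_card_ne_zero (by omega)
  by_cases hgen : AddSubgroup.closure {x | x ∈ as} = ⊤
  swap
  · refine missesColor_of_simplex_ne_univ (N := r) (by omega) fun hu => hgen ?_
    have := simplex_subset_closure r as
    rw [hu] at this
    exact AddSubgroup.ext fun x => ⟨fun _ => trivial, fun _ => this trivial⟩
  obtain ⟨pre, b, post, rfl, hpre, hpost⟩ := exists_first_max (fun x : Z => addOrderOf x)
    (as := as) (by rintro rfl; simp at hlen)
  have hb1 : 1 < addOrderOf b := by
    by_contra hb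
    have hall : ∀ x ∈ pre ++ b :: post, x = 0 := by
      intro x hx
      rw [← AddMonoid.addOrderOf_eq_one_iff]
      have := addOrderOf_pos x
      simp only [List.mem_append, List.mem_cons] at hx
      rcases hx with hx | rfl | hx
      · have := hpre x hx; omega
      · omega
      · have := hpost x hx; omega
    have hbot : (⊤ : AddSubgroup Z) = ⊥ := by
      rw [← hgen, eq_bot_iff, AddSubgroup.closure_le]
      exact fun x hx => hall x hx
    have : Nat.card (⊤ : AddSubgroup Z) = 1 := by rw [hbot]; simp
    simp at this
    omega
  have hdvd : addOrderOf b ∣ M := hcard ▸ addOrderOf_dvd_natCard b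
  have hle : addOrderOf b ≤ M := Nat.le_of_dvd (by omega) hdvd
  simp only [check, force_eq] at hc
  have hc1 := allRange_eq_true hc (addOrderOf b) (Nat.lt_succ_of_le hle)
  rw [show Nat.ble (addOrderOf b) 1 = false by rw [← Bool.not_eq_true, Nat.ble_eq]; omega,
    cond_false, show Nat.beq (Nat.mod M (addOrderOf b)) 0 = true from
      beq_mod_of_dvd hdvd, cond_true] at hc1
  -- start from the cyclic group generated by `b`, with the simplices on the empty list
  have hcod := coding_zmultiples (a := b) (by omega) rfl
  obtain ⟨S, hgS, hSl, hS⟩ := addElt_sound hcod (j := 0) (as := []) (S := List.replicate r 1) hb1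
    (by rw [simplex_zero]; exact covers_one hcod) (by
      have : ∀ r j, IsSimplexState (fun p => p • b) (addOrderOf b) [] j (List.replicate r 1) := by
        intro r
        induction r with
        | zero => exact fun j => trivial
        | succ r ih => exact fun j => ⟨by rw [simplex_nil]; exact covers_one hcod, ih _⟩
      exact this r 1) hc1
  refine generators_sound hcard hM hle hl hr hpre hcod hb1 (one_nsmul b) (by simp)
    (rest := pre ++ post) (k := l) (by simpa using hS) (by simpa using hSl)
    (by simp at hlen ⊢; omega) (by simp)
    ?_ ?_ (by simp) hgS
  · intro x hx
    rcases List.mem_append.1 hx with hx | hx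
    · exact (hpre x hx).le
    · exact hpost x hx
  · rw [eq_top_iff, ← hgen, AddSubgroup.closure_le]
    intro x hx
    simp only [Set.mem_ofPred_eq, List.mem_append, List.mem_cons] at hx
    by_cases hxb : x = b
    · subst hxb
      exact (le_sup_left : AddSubgroup.zmultiples x ≤ _) (AddSubgroup.mem_zmultiples x)
    · exact (le_sup_right : AddSubgroup.closure {x | x ∈ pre ++ post} ≤ _)
        (AddSubgroup.subset_closure (by simp; tauto))

end

end

/-! ### Subcubes as words -/

section

variable {Z : Type*} [AddCommGroup Z]

/-- The color of the subcube given by a word, for the linear coloring with values `as` on the unit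
vectors. -/
def color : List (Option Bool) → List Z → Z
  | [], _ => 0
  | some false :: L, as => color L as
  | some true :: L, as => as.headD 0 + color L as
  | none :: L, as => color L as.tail

/-- The recursion computes the colors of the subcubes contained in a given one, since containment
means that letters agree except at stars of the larger subcube. -/
theorem mem_colorSet_iff {D : List (Option Bool)} {as : List Z} {z : Z} :
    z ∈ colorSet D as ↔ ∃ A, List.Forall₂ (fun a d => d = none ∨ a = d) A D ∧
      A.count none + 1 = as.length ∧ color A as = z := by
  induction D generalizing as z with
  | nil =>
    simp only [colorSet, Set.mem_ofPred_eq, List.forall₂_nil_right_iff, exists_eq_left, color,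
      List.count_nil, zero_add]
    constructor <;> rintro ⟨h1, h2⟩ <;> exact ⟨h1.symm, h2.symm⟩
  | cons d D ih =>
    simp only [List.forall₂_cons_right_iff]
    have htail : ∀ k, k + 1 + 1 = as.length ↔ k + 1 = as.tail.length ∧ as ≠ [] := by
      intro k; cases as <;> simp
    have h0 : z ∈ colorSet D as.tail → as ≠ [] := by
      rintro h rfl
      rw [List.tail_nil, colorSet_nil_right] at h
      exact h
    rcases d with _ | _ | _
    · simp only [colorSet, Set.mem_union, Set.mem_vadd_set, vadd_eq_add, ih]
      constructor
      · rintro ((⟨A, h1, h2, h3⟩ | ⟨_, ⟨A, h1, h2, rfl⟩, h3⟩) | ⟨A, h1, h2, h3⟩)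
        · exact ⟨some false :: A, ⟨_, _, by simp, h1, rfl⟩, by simpa using h2, h3⟩
        · exact ⟨some true :: A, ⟨_, _, by simp, h1, rfl⟩, by simpa using h2, h3⟩
        · refine ⟨none :: A, ⟨_, _, by simp, h1, rfl⟩, ?_, h3⟩
          rw [List.count_cons_self, htail]
          exact ⟨h2, h0 (ih.2 ⟨A, h1, h2, h3⟩)⟩
      · rintro ⟨_, ⟨a, A, -, h1, rfl⟩, h2, h3⟩
        rcases a with _ | _ | _
        · rw [List.count_cons_self, htail] at h2
          exact Or.inr ⟨A, h1, h2.1, h3⟩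
        · exact Or.inl (Or.inl ⟨A, h1, by simpa using h2, h3⟩)
        · exact Or.inl (Or.inr ⟨_, ⟨A, h1, by simpa using h2, rfl⟩, h3⟩)
    · simp only [colorSet, ih]
      constructor
      · rintro ⟨A, h1, h2, h3⟩
        exact ⟨some false :: A, ⟨_, _, Or.inr rfl, h1, rfl⟩, by simpa using h2, h3⟩
      · rintro ⟨_, ⟨a, A, ha, h1, rfl⟩, h2, h3⟩
        obtain rfl : a = some false := by simpa using ha
        exact ⟨A, h1, by simpa using h2, h3⟩
    · simp only [colorSet, Set.mem_vadd_set, vadd_eq_add, ih]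
      constructor
      · rintro ⟨_, ⟨A, h1, h2, rfl⟩, h3⟩
        exact ⟨some true :: A, ⟨_, _, Or.inr rfl, h1, rfl⟩, by simpa using h2, h3⟩
      · rintro ⟨_, ⟨a, A, ha, h1, rfl⟩, h2, h3⟩
        obtain rfl : a = some true := by simpa using ha
        exact ⟨_, ⟨A, h1, by simpa using h2, rfl⟩, h3⟩

theorem forall₂_ofFn {α β : Type*} {R : α → β → Prop} {n : ℕ} {f : Fin n → α} {g : Fin n → β} :
    List.Forall₂ R (List.ofFn f) (List.ofFn g) ↔ ∀ i, R (f i) (g i) := by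
  induction n with
  | zero => simp
  | succ n ih => simp [List.ofFn_succ, ih, Fin.forall_fin_succ]

theorem count_ofFn_none {n : ℕ} (p : Fin n → Option Bool) :
    (List.ofFn p).count none = (Finset.univ.filter fun j => p j = none).card := by
  induction n with
  | zero => simp
  | succ n ih =>
    rw [List.ofFn_succ, List.count_cons, ih, Fin.card_filter_univ_succ]
    by_cases h : p 0 = none <;> simp [h]

theorem color_ofFn {n : ℕ} (p : Fin n → Option Bool) (as : List Z) :
    color (List.ofFn p) as = ∑ j, if p j = some true then
      as.getD (Finset.univ.filter fun m : Fin n => m < j ∧ p m = none).card 0 else 0 := by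
  induction n generalizing as with
  | zero => simp [color]
  | succ n ih =>
    rw [List.ofFn_succ, Fin.sum_univ_succ]
    have hcard : ∀ j : Fin n, (Finset.univ.filter fun m : Fin (n + 1) =>
        m < j.succ ∧ p m = none).card = (Finset.univ.filter fun m : Fin n =>
          m < j ∧ p m.succ = none).card + if p 0 = none then 1 else 0 := by
      intro j
      rw [Fin.card_filter_univ_succ]
      by_cases h : p 0 = none <;> simp [h]
    simp only [hcard, Fin.not_lt_zero, false_and, Finset.filter_false, Finset.card_empty]
    rcases hp : p 0 with _ | _ | _
    · simp only [color, ih, reduceCtorEq, if_false, if_true, zero_add]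
      refine Finset.sum_congr rfl fun j _ => ?_
      cases as <;> simp
    · simp [color, ih]
    · simp only [color, ih, if_true, reduceCtorEq, if_false, add_zero]
      congr 1
      cases as <;> simp

/-- A linear coloring is determined by its values on the unit vectors. -/
theorem map_countingVector {n l : ℕ} (A : Subcube n l) (f : (Fin (l + 1) → ℕ) →+ Z) :
    f A.countingVector =
      color (List.ofFn A.pattern) (List.ofFn fun i => f (Pi.single i 1)) := by
  classical
  have hf : ∀ v : Fin (l + 1) → ℕ, f v = ∑ i, v i • f (Pi.single i 1) := by
    intro v
    conv_lhs => rw [← Finset.univ_sum_single v]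
    rw [map_sum]
    refine Finset.sum_congr rfl fun i _ => ?_
    rw [← map_nsmul, ← Pi.single_smul, smul_eq_mul, mul_one]
  rw [hf, color_ofFn]
  simp only [Subcube.countingVector, Finset.card_filter, Finset.sum_smul]
  rw [Finset.sum_comm]
  refine Finset.sum_congr rfl fun j _ => ?_
  simp only [← Finset.card_filter]
  have hlt : (Finset.univ.filter fun m : Fin n => m < j ∧ A.pattern m = none).card < l + 1 := by
    refine Nat.lt_succ_of_le ?_
    conv_rhs => rw [← A.card_stars]
    exact Finset.card_le_card fun m hm => by simp at hm ⊢; exact hm.2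
  generalize (Finset.univ.filter fun m : Fin n => m < j ∧ A.pattern m = none).card = s at hlt ⊢
  by_cases h : A.pattern j = some true
  · rw [Finset.sum_eq_single ⟨s, hlt⟩]
    · rw [List.getD_eq_getElem _ _ (by simpa using hlt)]
      rw [List.getElem_ofFn, if_pos h]
      simp [h]
    · intro i _ hi
      rw [if_neg, zero_smul]
      rintro ⟨-, rfl⟩
      exact hi rfl
    · simp
  · simp [h]

end

theorem Subcube.vertices_subset_iff {n k d : ℕ} {A : Subcube n k} {D : Subcube n d} :
    A.vertices ⊆ D.vertices ↔ ∀ j, D.pattern j = none ∨ A.pattern j = D.pattern j := by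
  constructor
  · intro h j
    rcases hD : D.pattern j with _ | c
    · exact Or.inl rfl
    right
    -- replacing the stars of `A` by the opposite of `c` gives a vertex of `A`
    have hx := h (show (fun i => (A.pattern i).getD (!c)) ∈ A.vertices by
      intro i
      rcases hA : A.pattern i with _ | b <;> simp [hA]) j
    rw [hD] at hx
    rcases hA : A.pattern j with _ | b
    · simp [hA] at hx
    · simpa [hA, eq_comm] using hx
  · intro h x hx j
    rcases h j with hj | hj
    · exact Or.inl hj
    · exact hj ▸ hx j

/-- The subcube given by a word. -/
def Subcube.ofList {n k : ℕ} (L : List (Option Bool)) (hn : L.length = n) (hk : L.count none = k) :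
    Subcube n k where
  pattern := fun j => L[(j : ℕ)]
  card_stars := by
    subst hn
    rw [← count_ofFn_none, List.ofFn_getElem, hk]

theorem Subcube.ofFn_ofList {n k : ℕ} (L : List (Option Bool)) (hn : L.length = n)
    (hk : L.count none = k) : List.ofFn (Subcube.ofList L hn hk).pattern = L := by
  subst hn
  exact List.ofFn_getElem

/-- Linear colorings are lists of group elements, and being polychromatic means that no word
misses a color. -/
theorem hasLinearPolychromaticColoring_iff {n l d M : ℕ} :
    HasLinearPolychromaticColoring n l d M ↔ ∃ (Z : Type) (_ : AddCommGroup Z) (_ : Finite Z),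
      Nat.card Z = M ∧ ∃ as : List Z, as.length = l + 1 ∧ ∀ D : List (Option Bool),
        D.length = n → D.count none = d → colorSet D as = Set.univ := by
  constructor
  · rintro ⟨Z, _, _, c, hM, ⟨f, hf⟩, hc⟩
    refine ⟨Z, inferInstance, inferInstance, hM,
      List.ofFn fun i => f (Pi.single i 1), by simp, fun D hn hd => ?_⟩
    refine Set.eq_univ_of_forall fun z => ?_
    obtain ⟨A, hA, hz⟩ := hc (Subcube.ofList D hn hd) z
    refine mem_colorSet_iff.2 ⟨List.ofFn A.pattern, ?_, ?_, ?_⟩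
    · rw [← Subcube.ofFn_ofList D hn hd, forall₂_ofFn]
      exact Subcube.vertices_subset_iff.1 hA
    · rw [count_ofFn_none, A.card_stars]; simp
    · rw [← map_countingVector, ← hf, hz]
  · rintro ⟨Z, _, _, hM, as, hlen, has⟩
    let f : (Fin (l + 1) → ℕ) →+ Z :=
      { toFun := fun v => ∑ i, v i • as.getD i 0
        map_zero' := by simp
        map_add' := fun v w => by simp [add_smul, Finset.sum_add_distrib] }
    have hfas : (List.ofFn fun i => f (Pi.single i 1)) = as := by
      have hfi : ∀ i, f (Pi.single i 1) = as.getD i 0 := by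
        intro i
        change ∑ j, (Pi.single i 1 : Fin (l + 1) → ℕ) j • as.getD j 0 = _
        rw [Finset.sum_eq_single i]
        · simp
        · intro j _ hj; simp [Pi.single_eq_of_ne hj]
        · simp
      refine List.ext_getElem (by simp [hlen]) fun i h1 h2 => ?_
      rw [List.getElem_ofFn, hfi, List.getD_eq_getElem _ _ h2]
    refine ⟨Z, inferInstance, inferInstance, fun A => f A.countingVector, hM,
      ⟨f, fun _ => rfl⟩, fun D z => ?_⟩
    have hz : z ∈ colorSet (List.ofFn D.pattern) as := by
      rw [has _ (by simp) (by rw [count_ofFn_none, D.card_stars])]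
      trivial
    obtain ⟨A, hA, hk, rfl⟩ := mem_colorSet_iff.1 hz
    have hAn : A.length = n := by rw [hA.length_eq]; simp
    refine ⟨Subcube.ofList A hAn (by omega), ?_, ?_⟩
    · refine Subcube.vertices_subset_iff.2 ((forall₂_ofFn (R := fun a d => d = none ∨ a = d)).1 ?_)
      rwa [Subcube.ofFn_ofList]
    · change f _ = _
      rw [map_countingVector, hfas, Subcube.ofFn_ofList]

/-! ### Verified colorings -/

noncomputable section

/-- Effect of a star on the masks `Bs`, which belong to the suffixes of the list of values with
codes `cs`, longer ones first; the result is passed to `k`. -/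
def coverStar (t : ℕ → ℕ → ℕ) : List ℕ → List ℕ → (List ℕ → Bool) → Bool
  | c :: cs, B :: Bs, k => coverStar t cs Bs fun Cs =>
      force (Nat.lor (Nat.lor B (t c B)) (Bs.headD 0)) fun v => k (v :: Cs)
  | _, _, k => k []

/-- Some continuation of a word to the left by `j` stars, each of them preceded by fewer than `n`
ones, leads to a set different from the full mask `F`. -/
def uncovered (t : ℕ → ℕ → ℕ) (F n : ℕ) (cs : List ℕ) : ℕ → List ℕ → Bool
  | 0, Bs => not (Nat.beq (Bs.headD 0) F)
  | j + 1, Bs => anyIter (ones t cs) (fun Bs => coverStar t cs Bs (uncovered t F n cs j)) n Bs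

/-- Some word with `d` stars and fewer than `n` ones between them misses a color. -/
def uncoveredFrom (t : ℕ → ℕ → ℕ) (F n d : ℕ) (cs : List ℕ) : Bool :=
  coverStar t cs (List.replicate (cs.length - 1) 0 ++ [1]) (uncovered t F n cs (d - 1))

end

section

variable {Z : Type*} [AddCommGroup Z] {e : ℕ → Z} {M : ℕ} {t : ℕ → ℕ → ℕ}

theorem anyIter_eq_false {α : Type} {step : α → α} {test : α → Bool} {n : ℕ} {x : α}
    (h : anyIter step test n x = false) {k : ℕ} (hk : k < n) : test (step^[k] x) = false := by
  induction n generalizing x k with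
  | zero => omega
  | succ n ih =>
    change cond (test x) true (anyIter step test n (step x)) = false at h
    rcases hx : test x with _ | _
    · rw [hx] at h
      cases k with
      | zero => exact hx
      | succ k => exact ih h (by omega)
    · rw [hx] at h
      exact absurd h.symm Bool.false_ne_true

/-- The masks `Bs` represent, up to a common translation by `z`, the color sets of the word `D`
for the suffixes of the list of values with codes `cs`. -/
def IsExact (e : ℕ → Z) (M : ℕ) (z : Z) (D : List (Option Bool)) : List ℕ → List ℕ → Prop
  | c :: cs, B :: Bs => (B < 2 ^ M ∧ colorSet D ((c :: cs).map e) = z +ᵥ bitImage e B) ∧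
      IsExact e M z D cs Bs
  | [], [] => True
  | _, _ => False

theorem IsExact.ones (h : Coding ⊤ e M t) {z : Z} {D : List (Option Bool)} {cs Bs : List ℕ}
    (hcs : ∀ c ∈ cs, c < M) (hD : IsExact e M z D cs Bs) :
    IsExact e M z (some true :: D) cs (ones t cs Bs) := by
  induction cs generalizing Bs with
  | nil =>
    cases Bs with
    | nil => exact hD
    | cons => exact hD.elim
  | cons c cs ih =>
    cases Bs with
    | nil => exact hD
    | cons B Bs =>
      have hc := hcs c List.mem_cons_self
      refine ⟨⟨h.lt c hc B hD.1.1, ?_⟩, ih (fun c hc => hcs c (List.mem_cons_of_mem _ hc)) hD.2⟩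
      rw [h.image c hc B hD.1.1, vadd_comm, ← hD.1.2]
      rfl

theorem IsExact.headD {z : Z} {D : List (Option Bool)} {cs Bs : List ℕ}
    (hD : IsExact e M z D cs Bs) :
    Bs.headD 0 < 2 ^ M ∧ colorSet D (cs.map e) = z +ᵥ bitImage e (Bs.headD 0) := by
  cases cs <;> cases Bs
  · exact ⟨by simp, by simp [colorSet_nil_right, bitImage_zero]⟩
  · exact hD.elim
  · exact hD.elim
  · exact hD.1

theorem IsExact.coverStar (h : Coding ⊤ e M t) {z : Z} {D : List (Option Bool)} {cs Bs : List ℕ}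
    (hcs : ∀ c ∈ cs, c < M) (hD : IsExact e M z D cs Bs) {k : List ℕ → Bool}
    (hk : coverStar t cs Bs k = false) :
    ∃ Cs, k Cs = false ∧ IsExact e M z (none :: D) cs Cs := by
  induction cs generalizing Bs k with
  | nil =>
    cases Bs with
    | nil => exact ⟨[], hk, trivial⟩
    | cons => exact hD.elim
  | cons c cs ih =>
    cases Bs with
    | nil => exact hD.elim
    | cons B Bs =>
      have hc := hcs c List.mem_cons_self
      obtain ⟨Cs, hC, hC'⟩ := ih (fun c hc => hcs c (List.mem_cons_of_mem _ hc)) hD.2 hk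
      rw [force_eq] at hC
      obtain ⟨h1, h2⟩ := hD.2.headD
      refine ⟨_, hC, ⟨lor_lt (lor_lt hD.1.1 (h.lt c hc B hD.1.1)) h1, ?_⟩, hC'⟩
      change colorSet D _ ∪ (e c +ᵥ colorSet D _) ∪ colorSet D (cs.map e) = _
      rw [hD.1.2, h2, bitImage_lor, bitImage_lor, h.image c hc B hD.1.1, Set.vadd_set_union,
        Set.vadd_set_union, vadd_comm]

theorem colorSet_eq_of_count_none {D : List (Option Bool)} (hD : D.count none = 0) (as : List Z) :
    colorSet D as = {z | as.length = 1 ∧ z = D.count (some true) • as.headD 0} := by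
  induction D with
  | nil => simp [colorSet]
  | cons s D ih =>
    rcases s with _ | _ | _
    · simp at hD
    · simpa [colorSet] using ih (by simpa using hD)
    · rw [colorSet, ih (by simpa using hD)]
      ext z
      simp only [Set.mem_vadd_set, vadd_eq_add, Set.mem_ofPred_eq, List.count_cons_self,
        succ_nsmul']
      constructor
      · rintro ⟨_, ⟨h1, rfl⟩, rfl⟩; exact ⟨h1, rfl⟩
      · rintro ⟨h1, rfl⟩; exact ⟨_, ⟨h1, rfl⟩, rfl⟩

theorem isExact_of_count_none (h : Coding ⊤ e M t) {D : List (Option Bool)}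
    (hD : D.count none = 0) {cs : List ℕ} (hcs : cs ≠ []) :
    ∃ z, IsExact e M z D cs (List.replicate (cs.length - 1) 0 ++ [1]) := by
  induction cs with
  | nil => exact absurd rfl hcs
  | cons c cs ih =>
    rcases eq_or_ne cs [] with rfl | hne
    · refine ⟨D.count (some true) • e c, ⟨(covers_one h).1, ?_⟩, trivial⟩
      rw [colorSet_eq_of_count_none hD, bitImage_one, h.zero]
      ext z; simp
    · obtain ⟨z, hz⟩ := ih hne
      have hpos := List.length_pos_of_ne_nil hne
      rw [show (c :: cs).length - 1 = cs.length - 1 + 1 by simp; omega, List.replicate_succ,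
        List.cons_append]
      refine ⟨z, ⟨by positivity, ?_⟩, hz⟩
      rw [colorSet_eq_of_count_none hD, bitImage_zero, Set.vadd_set_empty,
        Set.eq_empty_iff_forall_notMem]
      rintro x ⟨hx, -⟩
      simp at hx
      exact hne hx

theorem colorSet_replicate_true (w : ℕ) (D : List (Option Bool)) (as : List Z) :
    colorSet (List.replicate w (some true) ++ D) as = (w • as.headD 0) +ᵥ colorSet D as := by
  induction w with
  | zero => simp
  | succ w ih =>
    rw [List.replicate_succ, List.cons_append, colorSet, ih, succ_nsmul', vadd_vadd]

/-- Every word has, up to translation and leading ones, the color sets of a word that the check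
has passed: ones after the last star translate all color sets by the same element, and the number
of ones between two stars matters only modulo the exponent `n`. -/
theorem exists_uncovered_eq_false (h : Coding ⊤ e M t) {n d : ℕ} (hn : 0 < n)
    (hexp : ∀ z : Z, n • z = 0) {cs : List ℕ} (hcs : ∀ c ∈ cs, c < M) (hne : cs ≠ [])
    (hu : uncoveredFrom t (2 ^ M - 1) n d cs = false) {D : List (Option Bool)} {j : ℕ}
    (hj : D.count none = j + 1) (hjd : j < d) :
    ∃ z w D' Bs, uncovered t (2 ^ M - 1) n cs (d - 1 - j) Bs = false ∧ IsExact e M z D' cs Bs ∧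
      ∀ as : List Z, colorSet D as = colorSet (List.replicate w (some true) ++ D') as := by
  induction D generalizing j with
  | nil => simp at hj
  | cons s D ih =>
    rcases s with _ | _ | _
    · cases j with
      | zero =>
        obtain ⟨z, hz⟩ := isExact_of_count_none h (D := D) (by simpa using hj) hne
        obtain ⟨Bs, h1, h2⟩ := hz.coverStar h hcs hu
        exact ⟨z, 0, _, Bs, h1, h2, fun as => rfl⟩
      | succ j =>
        obtain ⟨z, w, D', Bs, h1, h2, h3⟩ := ih (j := j) (by simpa using hj) (by omega)
        rw [show d - 1 - j = d - 1 - (j + 1) + 1 by omega] at h1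
        have h4 := anyIter_eq_false h1 (Nat.mod_lt w hn)
        have h5 := replicate_ones_step (P := fun D Bs => IsExact e M z D cs Bs)
          (fun D x hx => hx.ones h hcs) (w % n) h2
        obtain ⟨Cs, h6, h7⟩ := h5.coverStar h hcs h4
        refine ⟨z, 0, _, Cs, h6, h7, fun as => ?_⟩
        have h8 : ∀ as : List Z, colorSet D as =
            colorSet (List.replicate (w % n) (some true) ++ D') as := by
          intro as
          rw [h3, colorSet_replicate_true, colorSet_replicate_true,
            nsmul_eq_mod_nsmul w (hexp (as.headD 0))]
        simp only [List.replicate_zero, List.nil_append, colorSet, h8]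
    · obtain ⟨z, w, D', Bs, h1, h2, h3⟩ := ih (by simpa using hj) hjd
      exact ⟨z, w, D', Bs, h1, h2, h3⟩
    · obtain ⟨z, w, D', Bs, h1, h2, h3⟩ := ih (by simpa using hj) hjd
      refine ⟨z, w + 1, D', Bs, h1, h2, fun as => ?_⟩
      rw [List.replicate_succ, List.cons_append, colorSet, colorSet, h3]

theorem Coding.bitImage_eq_univ (h : Coding ⊤ e M t) : bitImage e (2 ^ M - 1) = Set.univ := by
  refine Set.eq_univ_of_forall fun z => ?_
  obtain ⟨p, hp, rfl⟩ := (h.mem z).1 trivial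
  exact ⟨p, by simp [Nat.testBit_two_pow_sub_one, hp], rfl⟩

theorem colorSet_eq_univ_of_uncoveredFrom (h : Coding ⊤ e M t) {n d : ℕ} (hn : 0 < n) (hd : 0 < d)
    (hexp : ∀ z : Z, n • z = 0) {cs : List ℕ} (hcs : ∀ c ∈ cs, c < M) (hne : cs ≠ [])
    (hu : uncoveredFrom t (2 ^ M - 1) n d cs = false) {D : List (Option Bool)}
    (hD : D.count none = d) : colorSet D (cs.map e) = Set.univ := by
  obtain ⟨z, w, D', Bs, h1, h2, h3⟩ :=
    exists_uncovered_eq_false h hn hexp hcs hne hu (D := D) (j := d - 1) (by omega) (by omega)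
  rw [Nat.sub_self] at h1
  have h4 : Bs.headD 0 = 2 ^ M - 1 := Nat.eq_of_beq_eq_true (by simpa [uncovered] using h1)
  rw [h3, colorSet_replicate_true, h2.headD.2, h4, h.bitImage_eq_univ, Set.vadd_set_univ,
    Set.vadd_set_univ]

end

theorem exists_coding_prod {m n : ℕ} (hm : 0 < m) (hn : 0 < n) :
    ∃ e : ℕ → ZMod m × ZMod n,
      Coding ⊤ e (m * n) (extTranslate (rotate (2 ^ m)) m (2 ^ m) n 0) := by
  have : NeZero m := ⟨hm.ne'⟩
  have : NeZero n := ⟨hn.ne'⟩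
  have ho : addOrderOf ((1, 0) : ZMod m × ZMod n) = m := by
    rw [Prod.addOrderOf_mk, ZMod.addOrderOf_one, addOrderOf_zero, Nat.lcm_one_right]
  have h := (coding_zmultiples hm ho).ext (a := ((0, 1) : ZMod m × ZMod n)) (n := n) (r := 0) hn hm
    (by simp) (by
      intro k hk hkn hmem
      obtain ⟨i, hi⟩ := AddSubgroup.mem_zmultiples_iff.1 hmem
      have h2 : ((k : ℕ) : ZMod n) = 0 := by simpa using (congrArg Prod.snd hi).symm
      have := Nat.le_of_dvd hk ((ZMod.natCast_eq_zero_iff k n).1 h2)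
      omega)
  have htop : AddSubgroup.zmultiples ((1, 0) : ZMod m × ZMod n) ⊔
      AddSubgroup.zmultiples ((0, 1) : ZMod m × ZMod n) = ⊤ := by
    rw [← AddSubgroup.card_eq_iff_eq_top, h.card_eq]
    simp
  rw [htop] at h
  exact ⟨_, h⟩

theorem hasLinearPolychromaticColoring_of_uncoveredFrom {l d m n N : ℕ} (hm : 0 < m) (hnm : n ∣ m)
    (hd : 0 < d) {cs : List ℕ} (hlen : cs.length = l + 1) (hcs : ∀ c ∈ cs, c < m * n)
    (hu : uncoveredFrom (extTranslate (rotate (2 ^ m)) m (2 ^ m) n 0) (2 ^ (m * n) - 1) m d cs =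
      false) : HasLinearPolychromaticColoring N l d (m * n) := by
  have hn : 0 < n := Nat.pos_of_dvd_of_pos hnm hm
  have : NeZero m := ⟨hm.ne'⟩
  have : NeZero n := ⟨hn.ne'⟩
  obtain ⟨e, he⟩ := exists_coding_prod hm hn
  refine hasLinearPolychromaticColoring_iff.2 ⟨ZMod m × ZMod n, inferInstance, inferInstance,
    by simp, cs.map e, by simpa using hlen, fun D _ hD => ?_⟩
  refine colorSet_eq_univ_of_uncoveredFrom he hm hd ?_ hcs (by rintro rfl; simp at hlen) hu hD
  rintro ⟨x, y⟩
  obtain ⟨k, rfl⟩ := hnm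
  ext <;> simp

set_option maxRecDepth 100000 in
/-- The colorings of `6 = 6 * 1`, `9 = 3 * 3`, `6`, `16 = 4 * 4`, `12 = 6 * 2` and `9` colors use
the groups `ZMod m × ZMod n` for these factorizations; `cs` lists the codes `x + m * y` of the
values `(x, y)`, which were found by a computer search. -/
theorem hasLinearPolychromaticColoring_attained (N : ℕ) : HasLinearPolychromaticColoring N 2 4 6 ∧
    HasLinearPolychromaticColoring N 2 5 9 ∧ HasLinearPolychromaticColoring N 3 5 6 ∧
    HasLinearPolychromaticColoring N 2 6 16 ∧ HasLinearPolychromaticColoring N 3 6 12 ∧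
    HasLinearPolychromaticColoring N 4 6 9 := by
  refine ⟨?_, ?_, ?_, ?_, ?_, ?_⟩
  · exact hasLinearPolychromaticColoring_of_uncoveredFrom (m := 6) (n := 1) (cs := [2, 5, 1])
      (by decide) (by decide) (by decide) rfl (by decide) (by decide +kernel)
  · exact hasLinearPolychromaticColoring_of_uncoveredFrom (m := 3) (n := 3) (cs := [4, 3, 1])
      (by decide) (by decide) (by decide) rfl (by decide) (by decide +kernel)
  · exact hasLinearPolychromaticColoring_of_uncoveredFrom (m := 6) (n := 1) (cs := [2, 5, 1, 0])
      (by decide) (by decide) (by decide) rfl (by decide) (by decide +kernel)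
  · exact hasLinearPolychromaticColoring_of_uncoveredFrom (m := 4) (n := 4) (cs := [15, 4, 1])
      (by decide) (by decide) (by decide) rfl (by decide) (by decide +kernel)
  · exact hasLinearPolychromaticColoring_of_uncoveredFrom (m := 6) (n := 2) (cs := [10, 8, 2, 1])
      (by decide) (by decide) (by decide) rfl (by decide) (by decide +kernel)
  · exact hasLinearPolychromaticColoring_of_uncoveredFrom (m := 3) (n := 3) (cs := [3, 4, 2, 3, 1])
      (by decide) (by decide) (by decide) rfl (by decide) (by decide +kernel)

/-! ### Excluded numbers of colors -/

/-- No linear coloring with `M` colors is `d`-polychromatic in all dimensions, in a form that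
exhibits words of bounded length. -/
def NoColoring (l d M : ℕ) : Prop :=
  ∀ (Z : Type) [AddCommGroup Z], Nat.card Z = M →
    ∀ as : List Z, as.length = l + 1 → MissesColor M d as

theorem NoColoring.not_forall {l d M : ℕ} (h : NoColoring l d M) :
    ¬ ∀ n, d ≤ n → HasLinearPolychromaticColoring n l d M := by
  intro hall
  obtain ⟨Z, _, _, hM, as, hlen, has⟩ := hasLinearPolychromaticColoring_iff.1
    (hall (d * (M + 1)) (Nat.le_mul_of_pos_right _ (Nat.succ_pos _)))
  obtain ⟨D, h1, h2, h3⟩ := h Z hM as hlen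
  -- zeros in front of a word do not change its colors
  refine h3 ?_
  rw [← colorSet_replicate_false (d * (M + 1) - D.length)]
  exact has _ (by simp; omega) (by simp [List.count_replicate, h1])

theorem noColoring_of_choose_lt {l d M : ℕ} (hld : l ≤ d) (h : (d + 1).choose (l + 1) < M) :
    NoColoring l d M := by
  intro Z _ hM as hlen
  have : Finite Z := Nat.finite_of_card_ne_zero (by omega)
  refine missesColor_of_simplex_ne_univ (N := d - l) (by omega) fun hu => ?_
  have := (ncard_simplex_le (d - l) as).2
  rw [hu, Set.ncard_univ, hM, hlen, show d - l + (l + 1) = d + 1 by omega] at this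
  omega

/-- A color missed in the quotient by an element of order two lifts to a color missed in the
group. -/
theorem NoColoring.two_mul {l d m : ℕ} (hm : 0 < m) (h : NoColoring l d m) :
    NoColoring l d (2 * m) := by
  intro Z _ hM as hlen
  have : Finite Z := Nat.finite_of_card_ne_zero (by omega)
  have : Fact (Nat.Prime 2) := ⟨Nat.prime_two⟩
  obtain ⟨x, hx⟩ := exists_prime_addOrderOf_dvd_card' (G := Z) 2 (hM ▸ Dvd.intro m rfl)
  have hcard : Nat.card (Z ⧸ AddSubgroup.zmultiples x) = m := by
    have := AddSubgroup.card_eq_card_quotient_mul_card_addSubgroup (AddSubgroup.zmultiples x)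
    rw [hM, Nat.card_zmultiples, hx] at this
    omega
  obtain ⟨D, h1, h2, h3⟩ := h _ hcard (as.map (QuotientAddGroup.mk' _)) (by simpa using hlen)
  refine ⟨D, h1, h2.trans (Nat.mul_le_mul_left _ (by omega)), fun hu => h3 ?_⟩
  rw [colorSet_map, hu, Set.image_univ, Set.range_eq_univ]
  exact QuotientAddGroup.mk'_surjective _

/-- The numbers of colors to be excluded are bounded by the size of a simplex, and those not in
`L` are halved. -/
theorem isPLin_of_check {l d p : ℕ} (r : ℕ) (L : List ℕ) (hd : l + r = d) (hl : 2 ≤ l) (hr : 1 ≤ r)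
    (hp : ∀ n, HasLinearPolychromaticColoring n l d p) (hL : ∀ m ∈ L, 1 < m)
    (hc : ∀ m ∈ L, check l r m = true)
    (hcover : ∀ M ≤ (d + 1).choose (l + 1), p < M → M ∈ L ∨ ∃ m ∈ L, 2 * m = M) :
    IsPLin l d p := by
  subst hd
  have hNC : ∀ m ∈ L, NoColoring l (l + r) m := fun m hm Z _ hcard as hlen =>
    check_sound hl hr (hL m hm) (hc m hm) hcard hlen
  refine ⟨fun n _ => hp n, fun M hM => not_lt.1 fun hlt => NoColoring.not_forall ?_ hM⟩
  rcases lt_or_ge ((l + r + 1).choose (l + 1)) M with h | h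
  · exact noColoring_of_choose_lt (by omega) h
  · rcases hcover M h hlt with hM | ⟨m, hm, rfl⟩
    · exact hNC M hM
    · exact (hNC m hm).two_mul (by have := hL m hm; omega)

/-! ### Evaluated checks -/

set_option maxRecDepth 1000000 in
theorem check_two_two : ∀ m ∈ ([7, 8, 9, 10] : List ℕ), check 2 2 m = true := by
  decide +kernel

set_option maxRecDepth 1000000 in
theorem check_three_two : ∀ m ∈ ([7, 8, 9, 10, 11, 12, 13, 15] : List ℕ), check 3 2 m = true := by
  decide +kernel

set_option maxRecDepth 1000000 in
theorem check_two_three : ∀ m ∈ ([10, 11, 12, 13, 14, 15, 16, 17, 18, 19] : List ℕ),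
    check 2 3 m = true := by
  decide +kernel

set_option maxRecDepth 1000000 in
theorem check_two_four : ∀ m ∈
    ([17, 18, 19, 20, 21, 22, 23, 24, 25, 26, 27, 28, 29,
      30, 31, 32, 33, 35] : List ℕ), check 2 4 m = true := by
  decide +kernel

set_option maxRecDepth 1000000 in
theorem check_three_three_13 : check 3 3 13 = true := by
  decide +kernel

set_option maxRecDepth 1000000 in
theorem check_three_three_14 : check 3 3 14 = true := by
  decide +kernel

set_option maxRecDepth 1000000 in
theorem check_three_three_15 : check 3 3 15 = true := by
  decide +kernel

set_option maxRecDepth 1000000 in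
theorem check_three_three_16 : check 3 3 16 = true := by
  decide +kernel

set_option maxRecDepth 1000000 in
theorem check_three_three_18 : check 3 3 18 = true := by
  decide +kernel

set_option maxRecDepth 1000000 in
theorem check_three_three_le_21 : ∀ m ∈ ([17, 19, 20, 21] : List ℕ), check 3 3 m = true := by
  decide +kernel

set_option maxRecDepth 1000000 in
theorem check_three_three_ge_22 : ∀ m ∈ ([22, 23, 24, 25, 27, 29, 31, 33, 35] : List ℕ),
    check 3 3 m = true := by
  decide +kernel

set_option maxRecDepth 1000000 in
theorem check_four_two_10 : check 4 2 10 = true := by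
  decide +kernel

set_option maxRecDepth 1000000 in
theorem check_four_two_12 : check 4 2 12 = true := by
  decide +kernel

set_option maxRecDepth 1000000 in
theorem check_four_two_le_14 : ∀ m ∈ ([11, 13, 14] : List ℕ), check 4 2 m = true := by
  decide +kernel

set_option maxRecDepth 1000000 in
theorem check_four_two_ge_15 : ∀ m ∈ ([15, 16, 17, 18, 19, 21] : List ℕ), check 4 2 m = true := by
  decide +kernel

end Polychromatic

theorem proposition1p7 :
    Polychromatic.IsPLin 2 4 6 ∧ Polychromatic.IsPLin 2 5 9 ∧ Polychromatic.IsPLin 3 5 6 ∧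
      Polychromatic.IsPLin 2 6 16 ∧ Polychromatic.IsPLin 3 6 12 ∧ Polychromatic.IsPLin 4 6 9 := by
  have h := Polychromatic.hasLinearPolychromaticColoring_attained
  refine ⟨Polychromatic.isPLin_of_check 2 _ rfl (by norm_num) (by norm_num) (fun n => (h n).1)
      (by decide) Polychromatic.check_two_two (by decide),
    Polychromatic.isPLin_of_check 3 _ rfl (by norm_num) (by norm_num) (fun n => (h n).2.1)
      (by decide) Polychromatic.check_two_three (by decide),
    Polychromatic.isPLin_of_check 2 _ rfl (by norm_num) (by norm_num) (fun n => (h n).2.2.1)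
      (by decide) Polychromatic.check_three_two (by decide),
    Polychromatic.isPLin_of_check 4 _ rfl (by norm_num) (by norm_num) (fun n => (h n).2.2.2.1)
      (by decide) Polychromatic.check_two_four (by decide),
    Polychromatic.isPLin_of_check 3
      (13 :: 14 :: 15 :: 16 :: 18 :: ([17, 19, 20, 21] ++ [22, 23, 24, 25, 27, 29, 31, 33, 35]))
      rfl (by norm_num) (by norm_num) (fun n => (h n).2.2.2.2.1) (by decide) ?_ (by decide),
    Polychromatic.isPLin_of_check 2 (10 :: 12 :: ([11, 13, 14] ++ [15, 16, 17, 18, 19, 21]))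
      rfl (by norm_num) (by norm_num) (fun n => (h n).2.2.2.2.2) (by decide) ?_ (by decide)⟩
  · iterate 5 rw [List.forall_mem_cons]
    rw [List.forall_mem_append]
    exact ⟨Polychromatic.check_three_three_13, Polychromatic.check_three_three_14,
      Polychromatic.check_three_three_15, Polychromatic.check_three_three_16,
      Polychromatic.check_three_three_18, Polychromatic.check_three_three_le_21,
      Polychromatic.check_three_three_ge_22⟩
  · iterate 2 rw [List.forall_mem_cons]
    rw [List.forall_mem_append]
    exact ⟨Polychromatic.check_four_two_10, Polychromatic.check_four_two_12,
      Polychromatic.check_four_two_le_14, Polychromatic.check_four_two_ge_15⟩
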